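/- Let $s_{1,1}\in\mathbb R$ with $|s_{1,1}|<1$. Consider a positive definite linear functional $\mathcal F$ on $\mathbb R[x,y]$ (i.e. $\mathcal F(f^2)>0$ for $f\ne0$). For $n,m\ge0$ let $\mathbb P_{n,m}=(p^0_{n,m},\dots,p^m_{n,m})^t$, where $p^l_{n,m}$ has the form $p^l_{n,m}=k\,x^ny^l+\sum_{i<n,\,j\le m}k_{i,j}x^iy^j+\sum_{j<l}k_{n,j}x^ny^j$ with $k>0$, satisfies $\mathcal F\big((p^l_{n,m})^2\big)=1$, and satisfies $\mathcal F(p^l_{n,m}x^iy^j)=0$ whenever $i<n,\ j\le m$ or $i=n,\ j<l$. (These are the orthonormal polynomials for the lexicographical ordering.) Let $\tilde{\mathbb P}_{n,m}=(\tilde p^0_{n,m},\dots,\tilde p^n_{n,m})^t$ be the analogous polynomials with the roles of $x,n$ and $y,m$ interchanged, so that $\tilde p^l_{n,m}$ has leading monomial $x^ly^m$. With $\langle f,g\rangle=\mathcal F(fg^t)$, the parameters $s_{i,j}$ of $\mathcal F$ are $$s_{0,0}=\mathcal F(1),\quad s_{2n-1,0}=\langle x\mathbb P_{n-1,0},\mathbb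 P_{n-1,0}\rangle,\quad s_{2n,0}=\langle x\mathbb P_{n-1,0},\mathbb P_{n,0}\rangle,$$ $$s_{0,2m-1}=\langle y\tilde{\mathbb P}_{0,m-1},\tilde{\mathbb P}_{0,m-1}\rangle,\quad s_{0,2m}=\langle y\tilde{\mathbb P}_{0,m-1},\tilde{\mathbb P}_{0,m}\rangle,$$ $$s_{2n-1,2m-1}=\langle \mathbb P_{n,m-1},\tilde{\mathbb P}_{n-1,m}\rangle_{m,n},\quad s_{2n-1,2m}=-\langle y\mathbb P_{n,m-1},\tilde{\mathbb P}_{n-1,m}\rangle_{m,n},$$ $$s_{2n,2m-1}=\langle y\mathbb P_{n,m-1},\mathbb P_{n,m}\rangle_{m,m},\quad s_{2n,2m}=\langle y\mathbb P_{n,m-1},\mathbb P_{n,m}\rangle_{m,m+1}$$ for $n,m\ge1$ (matrix entries are numbered from $1$). There is exactly one such functional $\mathcal F$ (with exactly one pair of families $\mathbb P_{n,m}$, $\tilde{\mathbb P}_{n,m}$) whose parameters are $$s_{0,0}=1,\quad s_{2n-1,0}=0,\quad s_{2n,0}=\tfrac12,\quad s_{0,2m-1}=0,\quad s_{0,2m}=\tfrac12,$$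 $$s_{2n-1,2m-1}=s_{1,1},\quad s_{2n-1,2m}=0,\quad s_{2n,2m-1}=0,\quad s_{2n,2m}=\tfrac12\qquad(n,m\ge1),$$ and the resulting bivariate polynomials $\mathbb P_{n,m}(x,y)$ are orthonormal with respect to the measure $$d\mu(x,y)=\frac{4}{\pi^2}\,\frac{(1-s_{1,1}^2)\sqrt{1-x^2}\sqrt{1-y^2}}{4s_{1,1}^2(x^2+y^2)-4s_{1,1}(1+s_{1,1}^2)xy+(1-s_{1,1}^2)^2}\,dx\,dy$$ on $[-1,1]^2$, that is, for all $n,k,m\ge0$, $$\int_{[-1,1]^2}\mathbb P_{n,m}(x,y)\,\mathbb P_{k,m}(x,y)^t\,d\mu(x,y)=\delta_{n,k}I_{m+1},$$ where the entries of the integrand are integrable. -/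

import Mathlib

open MeasureTheory

namespace DGIM

noncomputable section

/-- Real polynomials in two variables; the variable `0` is `x` and the variable `1` is `y`. -/
abbrev Poly : Type := MvPolynomial (Fin 2) ℝ

/-- The polynomial `x`. -/
def X : Poly := MvPolynomial.X 0

/-- The polynomial `y`. -/
def Y : Poly := MvPolynomial.X 1

/-- The exponent of the monomial `x ^ i * y ^ j`. -/
def expo (i j : ℕ) : Fin 2 →₀ ℕ := Finsupp.single 0 i + Finsupp.single 1 j

/-- The value of a polynomial at a point `(x, y)` of the plane. -/
def value (f : Poly) (z : ℝ × ℝ) : ℝ := MvPolynomial.eval ![z.1, z.2] f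

/-- Column vectors `P n m` of polynomials, of length `m + 1` (lexicographical ordering). -/
abbrev LexFamily : Type := ∀ _ m : ℕ, Fin (m + 1) → Poly

/-- Column vectors `Q n m` of polynomials, of length `n + 1` (reverse lexicographical ordering). -/
abbrev RevLexFamily : Type := ∀ n _ : ℕ, Fin (n + 1) → Poly

/-- A linear functional on polynomials which is positive definite: this says that all the
moment matrices `H_{n,m} = (F (x ^ (i + k) * y ^ (j + l)))` are positive definite. -/
def IsPosDef (F : Poly →ₗ[ℝ] ℝ) : Prop := ∀ f : Poly, f ≠ 0 → 0 < F (f * f)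

/-- `P n m l` is the polynomial that Gram-Schmidt produces at the monomial `x ^ n * y ^ l` from
the monomials `x ^ i * y ^ j`, `i ≤ n`, `j ≤ m`, in the lexicographical ordering. -/
structure IsLexOrthonormal (F : Poly →ₗ[ℝ] ℝ) (P : LexFamily) : Prop where
  orthogonal : ∀ (n m : ℕ) (l : Fin (m + 1)) (i j : ℕ),
    (i < n ∧ j ≤ m) ∨ (i = n ∧ j < (l : ℕ)) → F (P n m l * (X ^ i * Y ^ j)) = 0
  normalized : ∀ (n m : ℕ) (l : Fin (m + 1)), F (P n m l * P n m l) = 1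
  triangular : ∀ (n m : ℕ) (l : Fin (m + 1)) (i j : ℕ),
    (P n m l).coeff (expo i j) ≠ 0 → (i < n ∧ j ≤ m) ∨ (i = n ∧ j ≤ (l : ℕ))
  leading_pos : ∀ (n m : ℕ) (l : Fin (m + 1)), 0 < (P n m l).coeff (expo n l)

/-- The same with the roles of the two variables interchanged: `Q n m l` is the polynomial that
Gram-Schmidt produces at the monomial `x ^ l * y ^ m` from the monomials `x ^ i * y ^ j`,
`i ≤ n`, `j ≤ m`, in the reverse lexicographical ordering. -/
structure IsRevLexOrthonormal (F : Poly →ₗ[ℝ] ℝ) (Q : RevLexFamily) : Prop where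
  orthogonal : ∀ (n m : ℕ) (l : Fin (n + 1)) (i j : ℕ),
    (j < m ∧ i ≤ n) ∨ (j = m ∧ i < (l : ℕ)) → F (Q n m l * (X ^ i * Y ^ j)) = 0
  normalized : ∀ (n m : ℕ) (l : Fin (n + 1)), F (Q n m l * Q n m l) = 1
  triangular : ∀ (n m : ℕ) (l : Fin (n + 1)) (i j : ℕ),
    (Q n m l).coeff (expo i j) ≠ 0 → (j < m ∧ i ≤ n) ∨ (j = m ∧ i ≤ (l : ℕ))
  leading_pos : ∀ (n m : ℕ) (l : Fin (n + 1)), 0 < (Q n m l).coeff (expo l m)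

/-- The matrix `⟨f, g⟩ = F (f * gᵀ)` of two vectors of polynomials. -/
def pairing (F : Poly →ₗ[ℝ] ℝ) {a b : ℕ} (f : Fin a → Poly) (g : Fin b → Poly) :
    Matrix (Fin a) (Fin b) ℝ :=
  Matrix.of fun i j => F (f i * g j)

/-- A functional with its two families of polynomials. -/
structure System where
  /-- the functional -/
  F : Poly →ₗ[ℝ] ℝ
  /-- the vectors `ℙ_{n,m}` -/
  P : LexFamily
  /-- the vectors `ℙ̃_{n,m}` -/
  Q : RevLexFamily

namespace System

variable (T : System)

/-- `A_{n+1,m} = ⟨x ℙ_{n,m}, ℙ_{n+1,m}⟩`. -/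
def A (n m : ℕ) : Matrix (Fin (m + 1)) (Fin (m + 1)) ℝ :=
  pairing T.F (fun i => X * T.P n m i) (T.P (n + 1) m)

/-- `B_{n,m} = ⟨x ℙ_{n,m}, ℙ_{n,m}⟩`. -/
def B (n m : ℕ) : Matrix (Fin (m + 1)) (Fin (m + 1)) ℝ :=
  pairing T.F (fun i => X * T.P n m i) (T.P n m)

/-- `Ã_{n,m+1} = ⟨y ℙ̃_{n,m}, ℙ̃_{n,m+1}⟩`. -/
def At (n m : ℕ) : Matrix (Fin (n + 1)) (Fin (n + 1)) ℝ :=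
  pairing T.F (fun i => Y * T.Q n m i) (T.Q n (m + 1))

/-- `B̃_{n,m} = ⟨y ℙ̃_{n,m}, ℙ̃_{n,m}⟩`. -/
def Bt (n m : ℕ) : Matrix (Fin (n + 1)) (Fin (n + 1)) ℝ :=
  pairing T.F (fun i => Y * T.Q n m i) (T.Q n m)

/-- `𝒦_{n+1,m+1} = ⟨ℙ_{n+1,m}, ℙ̃_{n,m+1}⟩`. -/
def K (n m : ℕ) : Matrix (Fin (m + 1)) (Fin (n + 1)) ℝ :=
  pairing T.F (T.P (n + 1) m) (T.Q n (m + 1))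

/-- `J¹_{n+1,m+1} = ⟨y ℙ_{n+1,m}, ℙ_{n+1,m+1}⟩`. -/
def J1 (n m : ℕ) : Matrix (Fin (m + 1)) (Fin (m + 2)) ℝ :=
  pairing T.F (fun i => Y * T.P (n + 1) m i) (T.P (n + 1) (m + 1))

/-- `J²_{n+1,m+1} = -⟨y ℙ_{n+1,m}, ℙ̃_{n,m+1}⟩`. -/
def J2 (n m : ℕ) : Matrix (Fin (m + 1)) (Fin (n + 1)) ℝ :=
  -pairing T.F (fun i => Y * T.P (n + 1) m i) (T.Q n (m + 1))

/-- The numbers `s i j` are the parameters of the system: on the two axes they are the total mass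
and the coefficients of the one dimensional three term recurrences, and at the level
`(n + 1, m + 1)` they are the last entries of `𝒦` and `J²` and the last two entries in the last
row of `J¹`. -/
structure HasParameters (s : ℕ → ℕ → ℝ) : Prop where
  zero_zero : s 0 0 = T.F 1
  odd_zero : ∀ n, s (2 * n + 1) 0 = T.B n 0 0 0
  even_zero : ∀ n, s (2 * n + 2) 0 = T.A n 0 0 0
  zero_odd : ∀ m, s 0 (2 * m + 1) = T.Bt 0 m 0 0
  zero_even : ∀ m, s 0 (2 * m + 2) = T.At 0 m 0 0
  odd_odd : ∀ n m, s (2 * n + 1) (2 * m + 1) = T.K n m (Fin.last m) (Fin.last n)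
  odd_even : ∀ n m, s (2 * n + 1) (2 * m + 2) = T.J2 n m (Fin.last m) (Fin.last n)
  even_odd : ∀ n m, s (2 * n + 2) (2 * m + 1) = T.J1 n m (Fin.last m) (Fin.last m).castSucc
  even_even : ∀ n m, s (2 * n + 2) (2 * m + 2) = T.J1 n m (Fin.last m) (Fin.last (m + 1))

/-- The system is constructed with the parameters `s`: the functional is positive definite, the
two families consist of its orthonormal polynomials in the two orderings, and its parameters
are the numbers `s i j`. -/
structure IsConstructedWith (s : ℕ → ℕ → ℝ) : Prop where
  posDef : IsPosDef T.F
  lex : IsLexOrthonormal T.F T.P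
  revLex : IsRevLexOrthonormal T.F T.Q
  parameters : T.HasParameters s

end System

/-- The parameters of the one parameter deformation of the two dimensional Chebyshev polynomials:
`s_{0,0} = 1`, `s_{i,j} = c` if `i` and `j` are odd, `s_{i,j} = 1 / 2` if `i` and `j` are even
and not both zero, and `s_{i,j} = 0` otherwise. -/
def chebyshevParameters (c : ℝ) (i j : ℕ) : ℝ :=
  if i = 0 ∧ j = 0 then 1
  else if Odd i ∧ Odd j then c
  else if Even i ∧ Even j then 1 / 2
  else 0

/-- The density of the deformed Chebyshev measure on the square `[-1, 1] × [-1, 1]`. -/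
def density (c : ℝ) (z : ℝ × ℝ) : ℝ :=
  4 / Real.pi ^ 2 *
    ((1 - c ^ 2) * √(1 - z.1 ^ 2) * √(1 - z.2 ^ 2) /
      (4 * c ^ 2 * (z.1 ^ 2 + z.2 ^ 2) - 4 * c * (1 + c ^ 2) * (z.1 * z.2) + (1 - c ^ 2) ^ 2))

/-- The deformed Chebyshev measure. -/
def chebyshevMeasure (c : ℝ) : Measure (ℝ × ℝ) :=
  (volume.restrict (Set.Icc (-1) 1 ×ˢ Set.Icc (-1) 1)).withDensity
    fun z => ENNReal.ofReal (density c z)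

end

end DGIM

namespace DGIM

noncomputable section

open Polynomial.Chebyshev (U)

/-! ### Polynomials with restricted support -/

/-! Uniqueness holds because the parameters fix the moments one at a time. Suppose the moments with
exponents in the boxes `[0, 2n+2] × [0, 2m]` and `[0, 2n] × [0, 2m+2]` are known. Four moments are
missing in the box `[0, 2n+2] × [0, 2m+2]`, and four parameters belong to this level. Three of them
are values of `F` at a product of polynomials that are determined by then, and the missing moment
enters with a nonzero coefficient (`eq_at_top`). The fourth fixes the leading coefficient of a
Gram-Schmidt polynomial that is already known up to scale; its normalization then yields the moment
at the corner (`IsGramSchmidt.eq_at_double`). On the axes two parameters per step suffice.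

It remains to exhibit one system with the prescribed parameters whose functional is integration
against the measure. With `c = s₁₁`, the density is, up to `4 / π²`, `√(1-x²) √(1-y²)` times the
Poisson kernel `∑ cⁿ U_n(x) U_n(y)` (`hasSum_U_mul_U`). Hence the form `B(f, g) = ∫ f(x) g(y) dμ` is
diagonal in the Chebyshev basis: `B(U_i, U_j) = cⁱ δ_ij`. For the shift `S : U_n ↦ U_{n+1}` this
says `B(Sf, Sg) = c B(f, g)`, `B(1, Sg) = B(Sf, 1) = 0` and `B(1, 1) = 1`, while `U_n U_i = δ_in +
S(U_{n-1} U_i)` for `i ≤ n`.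

These rules produce the orthonormal polynomials explicitly. In `corner`, `U_n(x) U_m(y) - c
U_{n-1}(x) U_{m-1}(y)`, the second term cancels all shifted contributions; it belongs to the leading
monomial `x^n y^m`. For `n ≥ 1` and `l < m`, the polynomial with leading monomial `x^n y^l` is a
multiple of `(U_n(x) - 2cy U_{n-1}(x) + c² U_{n-2}(x)) U_l(y)`. For fixed `y` the weight in `x` is
proportional to `√(1-x²)` over a quadratic polynomial, and the first factor is its Bernstein-Szegő
polynomial, with norm independent of `y`. The measure is symmetric in `x` and `y`, so the reverse
family is obtained by interchanging the variables. The parameters follow from the same rules and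
from quotients of leading coefficients. -/

lemma expo_apply_zero (i j : ℕ) : expo i j 0 = i := by simp [expo]

lemma expo_apply_one (i j : ℕ) : expo i j 1 = j := by simp [expo]

lemma expo_eq (d : Fin 2 →₀ ℕ) : expo (d 0) (d 1) = d := by
  ext k; fin_cases k <;> simp [expo]

lemma expo_add (i j k l : ℕ) : expo (i + k) (j + l) = expo i j + expo k l := by
  ext a; fin_cases a <;> simp [expo]

lemma expo_inj {i j k l : ℕ} : expo i j = expo k l ↔ i = k ∧ j = l := by
  constructor
  · intro h
    exact ⟨by simpa [expo] using DFunLike.congr_fun h 0,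
      by simpa [expo] using DFunLike.congr_fun h 1⟩
  · rintro ⟨rfl, rfl⟩; rfl

lemma monomial_expo (i j : ℕ) : MvPolynomial.monomial (expo i j) (1 : ℝ) = X ^ i * Y ^ j := by
  simp [X, Y, expo, MvPolynomial.X_pow_eq_monomial, MvPolynomial.monomial_mul]

/-- The polynomials all of whose exponents lie in `A`. -/
def supp (A : Set (ℕ × ℕ)) : Submodule ℝ Poly :=
  MvPolynomial.restrictSupport ℝ {d | (d 0, d 1) ∈ A}

lemma mem_supp {A : Set (ℕ × ℕ)} {f : Poly} :
    f ∈ supp A ↔ ∀ i j, f.coeff (expo i j) ≠ 0 → (i, j) ∈ A := by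
  rw [supp, MvPolynomial.mem_restrictSupport_iff]
  constructor
  · intro h i j hij
    simpa [expo] using h (Finset.mem_coe.2 (MvPolynomial.mem_support_iff.2 hij))
  · intro h d hd
    refine h _ _ ?_
    rw [expo_eq]
    exact MvPolynomial.mem_support_iff.1 hd

lemma supp_mono {A B : Set (ℕ × ℕ)} (h : A ⊆ B) : supp A ≤ supp B :=
  MvPolynomial.restrictSupport_mono _ fun _ hd => h hd

lemma supp_eq_span (A : Set (ℕ × ℕ)) :
    supp A = Submodule.span ℝ ((fun p : ℕ × ℕ => X ^ p.1 * Y ^ p.2) '' A) := by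
  rw [supp, MvPolynomial.restrictSupport_eq_span]
  congr 1
  ext f
  constructor
  · rintro ⟨d, hd, rfl⟩
    exact ⟨_, hd, by simp only [← monomial_expo, expo_eq]⟩
  · rintro ⟨⟨i, j⟩, hp, rfl⟩
    exact ⟨expo i j, by simpa [expo] using hp, by simp only [← monomial_expo]⟩

lemma X_pow_mul_Y_pow_mem_supp {A : Set (ℕ × ℕ)} {i j : ℕ} (h : (i, j) ∈ A) :
    X ^ i * Y ^ j ∈ supp A := by
  rw [supp_eq_span]
  exact Submodule.subset_span ⟨_, h, rfl⟩

lemma X_mem_supp : X ∈ supp {(1, 0)} := by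
  simpa using X_pow_mul_Y_pow_mem_supp (A := {(1, 0)}) (i := 1) (j := 0) rfl

lemma Y_mem_supp : Y ∈ supp {(0, 1)} := by
  simpa using X_pow_mul_Y_pow_mem_supp (A := {(0, 1)}) (i := 0) (j := 1) rfl

lemma mul_mem_supp {A B C : Set (ℕ × ℕ)} {f g : Poly} (hf : f ∈ supp A) (hg : g ∈ supp B)
    (h : ∀ p ∈ A, ∀ q ∈ B, p + q ∈ C) : f * g ∈ supp C := by
  have h1 := Submodule.mul_mem_mul hf hg
  rw [supp, supp, ← MvPolynomial.restrictSupport_add] at h1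
  refine MvPolynomial.restrictSupport_mono _ ?_ h1
  rintro _ ⟨d, hd, e, he, rfl⟩
  exact h _ hd _ he

/-- The hypothesis `h` says that the exponent splits in only one way as a sum from `A` and `B`, so a
single term of the convolution survives. It is applied to leading monomials. -/
lemma coeff_mul_of_mem_supp {A B : Set (ℕ × ℕ)} {f g : Poly} (hf : f ∈ supp A) (hg : g ∈ supp B)
    (i j k l : ℕ) (h : ∀ p ∈ A, ∀ q ∈ B, p + q = (i + k, j + l) → p = (i, j)) :
    (f * g).coeff (expo (i + k) (j + l)) = f.coeff (expo i j) * g.coeff (expo k l) := by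
  rw [MvPolynomial.coeff_mul, Finset.sum_eq_single (expo i j, expo k l)]
  · rintro ⟨d, e⟩ hde hne
    rw [Finset.HasAntidiagonal.mem_antidiagonal] at hde
    by_contra h0
    have hd := mem_supp.1 hf (d 0) (d 1) (by rw [expo_eq]; exact left_ne_zero_of_mul h0)
    have he := mem_supp.1 hg (e 0) (e 1) (by rw [expo_eq]; exact right_ne_zero_of_mul h0)
    have h2 : d + e = expo (i + k) (j + l) := hde
    have h3 := h _ hd _ he (by
      have a := DFunLike.congr_fun h2 0
      have b := DFunLike.congr_fun h2 1
      rw [expo_apply_zero] at a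
      rw [expo_apply_one] at b
      exact Prod.ext a b)
    rw [Prod.mk.injEq] at h3
    have h4 : d = expo i j := by rw [← expo_eq d, h3.1, h3.2]
    subst h4
    rw [expo_add] at h2
    exact hne (by rw [add_left_cancel h2])
  · intro h0
    exact absurd (Finset.HasAntidiagonal.mem_antidiagonal.2 (expo_add i j k l).symm) h0

lemma coeff_X_pow_mul_Y_pow (i j k l : ℕ) :
    (X ^ i * Y ^ j).coeff (expo k l) = if i = k ∧ j = l then 1 else 0 := by
  rw [← monomial_expo, MvPolynomial.coeff_monomial]
  simp only [expo_inj]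

lemma sub_coeff_smul_mem_supp {A : Set (ℕ × ℕ)} {f : Poly} {i j : ℕ}
    (hf : f ∈ supp (insert (i, j) A)) :
    f - f.coeff (expo i j) • (X ^ i * Y ^ j) ∈ supp (A \ {(i, j)}) := by
  rw [mem_supp]
  intro k l h
  rw [MvPolynomial.coeff_sub, MvPolynomial.coeff_smul, coeff_X_pow_mul_Y_pow] at h
  by_cases hkl : i = k ∧ j = l
  · obtain ⟨rfl, rfl⟩ := hkl
    simp at h
  · have h1 : f.coeff (expo k l) ≠ 0 := by simpa [hkl] using h
    have h2 := mem_supp.1 hf k l h1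
    have h3 : (k, l) ≠ (i, j) := fun e => hkl (by simpa [eq_comm] using e)
    exact ⟨h2.resolve_left h3, h3⟩

lemma eq_on_supp {F G : Poly →ₗ[ℝ] ℝ} {A : Set (ℕ × ℕ)}
    (h : ∀ i j, (i, j) ∈ A → F (X ^ i * Y ^ j) = G (X ^ i * Y ^ j)) {f : Poly} (hf : f ∈ supp A) :
    F f = G f := by
  rw [supp_eq_span] at hf
  refine LinearMap.eqOn_span (f := F) (g := G) ?_ hf
  rintro _ ⟨⟨i, j⟩, hp, rfl⟩
  exact h i j hp

lemma eq_zero_on_supp {F : Poly →ₗ[ℝ] ℝ} {A : Set (ℕ × ℕ)}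
    (h : ∀ i j, (i, j) ∈ A → F (X ^ i * Y ^ j) = 0) {f : Poly} (hf : f ∈ supp A) : F f = 0 :=
  eq_on_supp (G := 0) h hf

lemma functional_ext {F G : Poly →ₗ[ℝ] ℝ} (h : ∀ i j, F (X ^ i * Y ^ j) = G (X ^ i * Y ^ j)) :
    F = G :=
  LinearMap.ext fun f => eq_on_supp (A := Set.univ) (fun i j _ => h i j) (mem_supp.2 (by simp))

/-- If two functionals agree at a polynomial and at all its monomials except one, then they agree
at this monomial, too. -/
lemma eq_at_top {F G : Poly →ₗ[ℝ] ℝ} {A : Set (ℕ × ℕ)} {r : Poly} {a b : ℕ}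
    (hr : r ∈ supp (insert (a, b) A)) (hc : r.coeff (expo a b) ≠ 0) (h : F r = G r)
    (hA : ∀ i j, (i, j) ∈ A → (i, j) ≠ (a, b) → F (X ^ i * Y ^ j) = G (X ^ i * Y ^ j)) :
    F (X ^ a * Y ^ b) = G (X ^ a * Y ^ b) := by
  have h1 := eq_on_supp (F := F) (G := G) (fun i j hij => hA i j hij.1 hij.2)
    (sub_coeff_smul_mem_supp hr)
  rw [map_sub, map_sub, map_smul, map_smul, h, sub_right_inj] at h1
  simpa [hc] using h1

/-! ### Gram-Schmidt polynomials -/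

/-- `p` is what the Gram-Schmidt process produces at the monomial with exponent `(a, b)` from the
monomials with exponents in `A`. -/
structure IsGramSchmidt (F : Poly →ₗ[ℝ] ℝ) (A : Set (ℕ × ℕ)) (a b : ℕ) (p : Poly) : Prop where
  mem : p ∈ supp (insert (a, b) A)
  orthogonal : ∀ f ∈ supp A, F (p * f) = 0
  normalized : F (p * p) = 1
  leading_pos : 0 < p.coeff (expo a b)

/-- The exponents that precede `(n, l)` in the lexicographical ordering, with `j ≤ m`. -/
def lexBelow (n m l : ℕ) : Set (ℕ × ℕ) := {p | (p.1 < n ∧ p.2 ≤ m) ∨ (p.1 = n ∧ p.2 < l)}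

/-- The exponents that precede `(l, m)` in the reverse lexicographical ordering, with `i ≤ n`. -/
def revLexBelow (n m l : ℕ) : Set (ℕ × ℕ) := {p | (p.2 < m ∧ p.1 ≤ n) ∨ (p.2 = m ∧ p.1 < l)}

lemma IsLexOrthonormal.isGramSchmidt {F : Poly →ₗ[ℝ] ℝ} {P : LexFamily} (h : IsLexOrthonormal F P)
    (n m : ℕ) (l : Fin (m + 1)) : IsGramSchmidt F (lexBelow n m l) n l (P n m l) where
  mem := mem_supp.2 fun i j hij => by
    have := h.triangular n m l i j hij
    simp only [lexBelow, Set.mem_insert_iff, Prod.mk.injEq, Set.mem_ofPred_eq]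
    omega
  orthogonal f hf := eq_zero_on_supp (F := F ∘ₗ LinearMap.mulLeft ℝ (P n m l))
    (fun i j hij => h.orthogonal n m l i j hij) hf
  normalized := h.normalized n m l
  leading_pos := h.leading_pos n m l

lemma IsRevLexOrthonormal.isGramSchmidt {F : Poly →ₗ[ℝ] ℝ} {Q : RevLexFamily}
    (h : IsRevLexOrthonormal F Q) (n m : ℕ) (l : Fin (n + 1)) :
    IsGramSchmidt F (revLexBelow n m l) l m (Q n m l) where
  mem := mem_supp.2 fun i j hij => by
    have := h.triangular n m l i j hij
    simp only [revLexBelow, Set.mem_insert_iff, Prod.mk.injEq, Set.mem_ofPred_eq]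
    omega
  orthogonal f hf := eq_zero_on_supp (F := F ∘ₗ LinearMap.mulLeft ℝ (Q n m l))
    (fun i j hij => h.orthogonal n m l i j hij) hf
  normalized := h.normalized n m l
  leading_pos := h.leading_pos n m l

namespace IsGramSchmidt

variable {F G : Poly →ₗ[ℝ] ℝ} {A : Set (ℕ × ℕ)} {a b : ℕ} {p q : Poly}

/-- Cross-multiplying by the leading coefficients cancels the only monomial outside `A`. -/
lemma leading_smul_sub_mem (hp : p ∈ supp (insert (a, b) A)) (hq : q ∈ supp (insert (a, b) A)) :
    q.coeff (expo a b) • p - p.coeff (expo a b) • q ∈ supp A := by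
  have h := Submodule.sub_mem _
    (Submodule.smul_mem _ (q.coeff (expo a b)) (sub_coeff_smul_mem_supp hp))
    (Submodule.smul_mem _ (p.coeff (expo a b)) (sub_coeff_smul_mem_supp hq))
  refine supp_mono (Set.sdiff_subset (t := {(a, b)})) ?_
  convert h using 1
  rw [smul_sub, smul_sub, smul_smul, smul_smul, mul_comm]
  abel

/-- Gram-Schmidt polynomials of functionals that agree at the moments involved are proportional. -/
lemma proportional (hF : IsPosDef F) (hp : IsGramSchmidt F A a b p) (hq : IsGramSchmidt G A a b q)
    (hA : ∀ s ∈ insert (a, b) A, ∀ t ∈ A,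
      F (X ^ (s.1 + t.1) * Y ^ (s.2 + t.2)) = G (X ^ (s.1 + t.1) * Y ^ (s.2 + t.2))) :
    q.coeff (expo a b) • p = p.coeff (expo a b) • q := by
  set d := q.coeff (expo a b) • p - p.coeff (expo a b) • q with hd
  have hdA : d ∈ supp A := leading_smul_sub_mem hp.mem hq.mem
  have hqd : F (q * d) = G (q * d) := by
    refine eq_on_supp (A := {u | ∃ s ∈ insert (a, b) A, ∃ t ∈ A, u = s + t}) ?_
      (mul_mem_supp hq.mem hdA fun s hs t ht => ⟨s, hs, t, ht, rfl⟩)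
    rintro i j ⟨s, hs, t, ht, h⟩
    obtain ⟨rfl, rfl⟩ := Prod.mk.inj h
    exact hA s hs t ht
  -- `d` lies in the span of `A`, so it is orthogonal to `p` under `F` and to `q` under `G`, and the
  -- two functionals agree at `q * d`. Positive definiteness then forces `d = 0`.
  have h0 : F (d * d) = 0 := by
    have h1 : d * d = q.coeff (expo a b) • (p * d) - p.coeff (expo a b) • (q * d) := by
      conv_lhs => rw [hd]
      rw [sub_mul, smul_mul_assoc, smul_mul_assoc, ← hd]
    rw [h1, map_sub, map_smul, map_smul, hqd, hp.orthogonal d hdA, hq.orthogonal d hdA]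
    simp
  by_contra hne
  exact (hF d (sub_ne_zero.2 hne)).ne' h0

lemma eq_of_leading_eq (hp : IsGramSchmidt F A a b p)
    (h : q.coeff (expo a b) • p = p.coeff (expo a b) • q)
    (hpq : p.coeff (expo a b) = q.coeff (expo a b)) : p = q := by
  rw [← hpq] at h
  exact smul_right_injective Poly hp.leading_pos.ne' h

lemma eq (hF : IsPosDef F) (hp : IsGramSchmidt F A a b p) (hq : IsGramSchmidt G A a b q)
    (hA : ∀ s ∈ insert (a, b) A, ∀ t ∈ insert (a, b) A,
      F (X ^ (s.1 + t.1) * Y ^ (s.2 + t.2)) = G (X ^ (s.1 + t.1) * Y ^ (s.2 + t.2))) :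
    p = q := by
  have h := proportional hF hp hq fun s hs t ht => hA s hs t (Or.inr ht)
  refine eq_of_leading_eq hp h ?_
  -- Both arguments are the square of the same polynomial, so by normalization the leading
  -- coefficients have equal squares, and both are positive.
  have h1 : F ((q.coeff (expo a b) • p) * (q.coeff (expo a b) • p)) =
      G ((p.coeff (expo a b) • q) * (p.coeff (expo a b) • q)) := by
    rw [← h]
    refine eq_on_supp (A := {u | ∃ s ∈ insert (a, b) A, ∃ t ∈ insert (a, b) A, u = s + t}) ?_
      (mul_mem_supp (Submodule.smul_mem _ _ hp.mem) (Submodule.smul_mem _ _ hp.mem)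
        fun s hs t ht => ⟨s, hs, t, ht, rfl⟩)
    rintro i j ⟨s, hs, t, ht, h⟩
    obtain ⟨rfl, rfl⟩ := Prod.mk.inj h
    exact hA s hs t ht
  simp only [smul_mul_assoc, mul_smul_comm, map_smul, hp.normalized, hq.normalized, smul_eq_mul,
    mul_one] at h1
  have h2 := hp.leading_pos
  have h3 := hq.leading_pos
  nlinarith

/-- The coefficient of a polynomial with the same leading monomial with respect to a Gram-Schmidt
polynomial is the quotient of the leading coefficients. -/
lemma leading_mul_apply_mul (hp : IsGramSchmidt F A a b p) {r : Poly}
    (hr : r ∈ supp (insert (a, b) A)) :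
    p.coeff (expo a b) * F (r * p) = r.coeff (expo a b) := by
  have h := hp.orthogonal _ (leading_smul_sub_mem hr hp.mem)
  rw [mul_sub, mul_smul_comm, mul_smul_comm, map_sub, map_smul, map_smul, hp.normalized,
    smul_eq_mul, smul_eq_mul, mul_one, sub_eq_zero, mul_comm p] at h
  exact h

/-- Functionals that agree at the moments preceding `(2 a, 2 b)` agree at this moment, too, if the
coefficients of a common polynomial `r` with respect to their Gram-Schmidt polynomials agree. -/
lemma eq_at_double (hF : IsPosDef F) (hp : IsGramSchmidt F A a b p) (hq : IsGramSchmidt G A a b q)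
    (hA : ∀ s ∈ insert (a, b) A, ∀ t ∈ A,
      F (X ^ (s.1 + t.1) * Y ^ (s.2 + t.2)) = G (X ^ (s.1 + t.1) * Y ^ (s.2 + t.2)))
    (hnot : ∀ s ∈ insert (a, b) A, ∀ t ∈ A, s + t ≠ (a + a, b + b))
    {r : Poly} (hr : r ∈ supp (insert (a, b) A)) (hr0 : r.coeff (expo a b) ≠ 0)
    (hrpq : F (r * p) = G (r * q)) :
    F (X ^ (a + a) * Y ^ (b + b)) = G (X ^ (a + a) * Y ^ (b + b)) := by
  have h1 := leading_mul_apply_mul hp hr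
  have h2 := leading_mul_apply_mul hq hr
  have h3 : F (r * p) ≠ 0 := right_ne_zero_of_mul (h1.trans_ne hr0)
  rw [← hrpq, ← h1] at h2
  -- `F (r * p)` and `G (r * q)` are the quotients of the leading coefficient of `r` by those of `p`
  -- and `q`. Their equality upgrades proportionality to `p = q`.
  have hpq : p = q := eq_of_leading_eq hp (proportional hF hp hq hA) (mul_right_cancel₀ h3 h2).symm
  subst hpq
  have key : ∀ s ∈ insert (a, b) A, ∀ t ∈ insert (a, b) A, s + t = (a + a, b + b) ∨
      F (X ^ (s.1 + t.1) * Y ^ (s.2 + t.2)) = G (X ^ (s.1 + t.1) * Y ^ (s.2 + t.2)) := by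
    intro s hs t ht
    rcases ht with rfl | ht
    · rcases hs with rfl | hs
      · exact Or.inl rfl
      · right
        have := hA (a, b) (Or.inl rfl) s hs
        rwa [add_comm a, add_comm b] at this
    · exact Or.inr (hA s hs t ht)
  -- Both functionals take the value `1` at `p * p`, and by `key` they agree at each of its
  -- monomials except possibly the top one.
  refine eq_at_top (A := {u | ∃ s ∈ insert (a, b) A, ∃ t ∈ insert (a, b) A, u = s + t})
    (r := p * p) (mul_mem_supp hp.mem hp.mem fun s hs t ht => Or.inr ⟨s, hs, t, ht, rfl⟩) ?_
    (hp.normalized.trans hq.normalized.symm) ?_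
  · rw [coeff_mul_of_mem_supp hp.mem hp.mem]
    · exact mul_ne_zero hp.leading_pos.ne' hp.leading_pos.ne'
    · intro s hs t ht hst
      rcases hs with rfl | hs
      · rfl
      · exact absurd ((add_comm t s).trans hst) (hnot t ht s hs)
  · rintro i j ⟨s, hs, t, ht, h⟩ hne
    obtain ⟨rfl, rfl⟩ := Prod.mk.inj h
    exact (key s hs t ht).resolve_left hne

end IsGramSchmidt

/-! ### The parameters determine the system -/

/-- Two functionals have the same moments with exponents at most `2 n` in `x` and `2 m` in `y`. -/
def AgreeUpTo (F G : Poly →ₗ[ℝ] ℝ) (n m : ℕ) : Prop :=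
  ∀ i j, i ≤ 2 * n → j ≤ 2 * m → F (X ^ i * Y ^ j) = G (X ^ i * Y ^ j)

lemma IsLexOrthonormal.mem_box {F : Poly →ₗ[ℝ] ℝ} {P : LexFamily} (h : IsLexOrthonormal F P)
    (n m : ℕ) (l : Fin (m + 1)) : P n m l ∈ supp {p | p.1 ≤ n ∧ p.2 ≤ m} := by
  refine mem_supp.2 fun i j hij => ?_
  have := h.triangular n m l i j hij
  simp only [Set.mem_ofPred_eq]
  omega

lemma IsRevLexOrthonormal.mem_box {F : Poly →ₗ[ℝ] ℝ} {Q : RevLexFamily}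
    (h : IsRevLexOrthonormal F Q) (n m : ℕ) (l : Fin (n + 1)) :
    Q n m l ∈ supp {p | p.1 ≤ n ∧ p.2 ≤ m} := by
  refine mem_supp.2 fun i j hij => ?_
  have := h.triangular n m l i j hij
  simp only [Set.mem_ofPred_eq]
  omega

lemma AgreeUpTo.lex_eq {F G : Poly →ₗ[ℝ] ℝ} {n m : ℕ} (h : AgreeUpTo F G n m) (hF : IsPosDef F)
    {P P' : LexFamily} (hP : IsLexOrthonormal F P) (hP' : IsLexOrthonormal G P') :
    P n m = P' n m := by
  funext l
  refine (hP.isGramSchmidt n m l).eq hF (hP'.isGramSchmidt n m l) ?_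
  have hl := l.2
  rintro ⟨i, j⟩ h1 ⟨i', j'⟩ h2
  simp only [lexBelow, Set.mem_insert_iff, Prod.mk.injEq, Set.mem_ofPred_eq] at h1 h2
  exact h _ _ (by dsimp only; omega) (by dsimp only; omega)

lemma AgreeUpTo.revLex_eq {F G : Poly →ₗ[ℝ] ℝ} {n m : ℕ} (h : AgreeUpTo F G n m)
    (hF : IsPosDef F) {Q Q' : RevLexFamily} (hQ : IsRevLexOrthonormal F Q)
    (hQ' : IsRevLexOrthonormal G Q') : Q n m = Q' n m := by
  funext l
  refine (hQ.isGramSchmidt n m l).eq hF (hQ'.isGramSchmidt n m l) ?_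
  have hl := l.2
  rintro ⟨i, j⟩ h1 ⟨i', j'⟩ h2
  simp only [revLexBelow, Set.mem_insert_iff, Prod.mk.injEq, Set.mem_ofPred_eq] at h1 h2
  exact h _ _ (by dsimp only; omega) (by dsimp only; omega)

lemma coeff_X_mul (f : Poly) (i j : ℕ) :
    (X * f).coeff (expo (i + 1) j) = f.coeff (expo i j) := by
  have h : expo (i + 1) j = Finsupp.single 0 1 + expo i j := by
    rw [expo, expo, Finsupp.single_add]; abel
  rw [h, X, MvPolynomial.coeff_X_mul]

lemma coeff_Y_mul (f : Poly) (i j : ℕ) :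
    (Y * f).coeff (expo i (j + 1)) = f.coeff (expo i j) := by
  have h : expo i (j + 1) = Finsupp.single 1 1 + expo i j := by
    rw [expo, expo, Finsupp.single_add]; abel
  rw [h, Y, MvPolynomial.coeff_X_mul]

lemma X_mul_mem_supp {A B : Set (ℕ × ℕ)} {f : Poly} (hf : f ∈ supp A)
    (h : ∀ i j, (i, j) ∈ A → (i + 1, j) ∈ B) : X * f ∈ supp B :=
  mul_mem_supp X_mem_supp hf (by
    rintro _ rfl ⟨i, j⟩ hp
    have := h i j hp
    rwa [Prod.mk_add_mk, zero_add, add_comm])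

lemma Y_mul_mem_supp {A B : Set (ℕ × ℕ)} {f : Poly} (hf : f ∈ supp A)
    (h : ∀ i j, (i, j) ∈ A → (i, j + 1) ∈ B) : Y * f ∈ supp B :=
  mul_mem_supp Y_mem_supp hf (by
    rintro _ rfl ⟨i, j⟩ hp
    have := h i j hp
    rwa [Prod.mk_add_mk, zero_add, add_comm 1])

namespace System.IsConstructedWith

variable {T T' : System} {s : ℕ → ℕ → ℝ}

lemma agree_zero_zero (h : T.IsConstructedWith s) (h' : T'.IsConstructedWith s) :
    AgreeUpTo T.F T'.F 0 0 := by
  intro i j hi hj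
  obtain rfl : i = 0 := by omega
  obtain rfl : j = 0 := by omega
  have := h.parameters.zero_zero.symm.trans h'.parameters.zero_zero
  simpa using this

/-- The moment `x^(2n+1)` is the top moment in `F (x p²)`, where `p` is the polynomial of degree
`n`. The moment `x^(2n+2)` comes from `eq_at_double`, with `r = x p` compared to the polynomial of
degree `n + 1`. -/
lemma agree_succ_zero (h : T.IsConstructedWith s) (h' : T'.IsConstructedWith s) {n : ℕ}
    (ih : AgreeUpTo T.F T'.F n 0) : AgreeUpTo T.F T'.F (n + 1) 0 := by
  have hP := ih.lex_eq h.posDef h.lex h'.lex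
  have hb := h.lex.mem_box n 0 0
  have hlead := h.lex.leading_pos n 0 0
  have h1 : T.F (X ^ (2 * n + 1) * Y ^ 0) = T'.F (X ^ (2 * n + 1) * Y ^ 0) := by
    have e := h.parameters.odd_zero n
    rw [h'.parameters.odd_zero n] at e
    simp only [B, pairing, Matrix.of_apply, ← hP] at e
    have hX : X * T.P n 0 0 ∈ supp {p | p.1 ≤ n + 1 ∧ p.2 ≤ 0} :=
      X_mul_mem_supp hb fun i j hij => by
        simp only [Set.mem_ofPred_eq] at hij ⊢; omega
    refine eq_at_top (r := X * T.P n 0 0 * T.P n 0 0) (A := {p | p.1 ≤ 2 * n + 1 ∧ p.2 ≤ 0})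
      (mul_mem_supp hX hb ?_) ?_ e.symm ?_
    · rintro ⟨i, j⟩ h1 ⟨i', j'⟩ h2
      simp only [Set.mem_ofPred_eq, Prod.mk_add_mk, Set.mem_insert_iff, Prod.mk.injEq] at h1 h2 ⊢
      omega
    · have := coeff_mul_of_mem_supp hX hb (n + 1) 0 n 0 (by
        rintro ⟨i, j⟩ h1 ⟨i', j'⟩ h2 h3
        simp only [Set.mem_ofPred_eq, Prod.mk_add_mk, Prod.mk.injEq] at h1 h2 h3 ⊢
        omega)
      rw [show 2 * n + 1 = n + 1 + n by omega]
      rw [add_zero, coeff_X_mul] at this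
      rw [this]
      exact mul_ne_zero hlead.ne' hlead.ne'
    · intro i j hij hne
      simp only [Set.mem_ofPred_eq, ne_eq, Prod.mk.injEq] at hij hne
      exact ih i j (by omega) (by omega)
  have h2 : T.F (X ^ (n + 1 + (n + 1)) * Y ^ (0 + 0)) =
      T'.F (X ^ (n + 1 + (n + 1)) * Y ^ (0 + 0)) := by
    have e := h.parameters.even_zero n
    rw [h'.parameters.even_zero n] at e
    simp only [System.A, pairing, Matrix.of_apply, ← hP] at e
    refine (h.lex.isGramSchmidt (n + 1) 0 0).eq_at_double h.posDef
      (h'.lex.isGramSchmidt (n + 1) 0 0) ?_ ?_ (r := X * T.P n 0 0) ?_ ?_ e.symm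
    · rintro ⟨i, j⟩ h1 ⟨i', j'⟩ h2
      simp only [lexBelow, Set.mem_insert_iff, Prod.mk.injEq, Set.mem_ofPred_eq] at h1 h2
      dsimp only
      by_cases hi : i + i' = 2 * n + 1
      · have hj : j + j' = 0 := by simp at h1 h2; omega
        rwa [hi, hj]
      · exact ih _ _ (by simp at h1 h2; omega) (by simp at h1 h2; omega)
    · rintro ⟨i, j⟩ h1 ⟨i', j'⟩ h2
      simp only [lexBelow, Set.mem_insert_iff, Prod.mk.injEq, Set.mem_ofPred_eq, Prod.mk_add_mk,
        ne_eq] at h1 h2 ⊢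
      simp at h1 h2
      omega
    · refine X_mul_mem_supp hb fun i j hij => ?_
      simp only [lexBelow, Set.mem_insert_iff, Prod.mk.injEq, Set.mem_ofPred_eq] at hij ⊢
      simp
      omega
    · rw [coeff_X_mul]
      exact hlead.ne'
  intro i j hi hj
  obtain rfl : j = 0 := by omega
  rcases (by omega : i ≤ 2 * n ∨ i = 2 * n + 1 ∨ i = n + 1 + (n + 1)) with hi | rfl | rfl
  · exact ih i 0 hi (by omega)
  · exact h1
  · exact h2

lemma agree_zero_succ (h : T.IsConstructedWith s) (h' : T'.IsConstructedWith s) {m : ℕ}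
    (ih : AgreeUpTo T.F T'.F 0 m) : AgreeUpTo T.F T'.F 0 (m + 1) := by
  have hQ := ih.revLex_eq h.posDef h.revLex h'.revLex
  have hb := h.revLex.mem_box 0 m 0
  have hlead := h.revLex.leading_pos 0 m 0
  have h1 : T.F (X ^ 0 * Y ^ (2 * m + 1)) = T'.F (X ^ 0 * Y ^ (2 * m + 1)) := by
    have e := h.parameters.zero_odd m
    rw [h'.parameters.zero_odd m] at e
    simp only [Bt, pairing, Matrix.of_apply, ← hQ] at e
    have hY : Y * T.Q 0 m 0 ∈ supp {p | p.1 ≤ 0 ∧ p.2 ≤ m + 1} :=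
      Y_mul_mem_supp hb fun i j hij => by
        simp only [Set.mem_ofPred_eq] at hij ⊢; omega
    refine eq_at_top (r := Y * T.Q 0 m 0 * T.Q 0 m 0) (A := {p | p.1 ≤ 0 ∧ p.2 ≤ 2 * m + 1})
      (mul_mem_supp hY hb ?_) ?_ e.symm ?_
    · rintro ⟨i, j⟩ h1 ⟨i', j'⟩ h2
      simp only [Set.mem_ofPred_eq, Prod.mk_add_mk, Set.mem_insert_iff, Prod.mk.injEq] at h1 h2 ⊢
      omega
    · have := coeff_mul_of_mem_supp hY hb 0 (m + 1) 0 m (by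
        rintro ⟨i, j⟩ h1 ⟨i', j'⟩ h2 h3
        simp only [Set.mem_ofPred_eq, Prod.mk_add_mk, Prod.mk.injEq] at h1 h2 h3 ⊢
        omega)
      rw [show 2 * m + 1 = m + 1 + m by omega]
      rw [add_zero, coeff_Y_mul] at this
      rw [this]
      exact mul_ne_zero hlead.ne' hlead.ne'
    · intro i j hij hne
      simp only [Set.mem_ofPred_eq, ne_eq, Prod.mk.injEq] at hij hne
      exact ih i j (by omega) (by omega)
  have h2 : T.F (X ^ (0 + 0) * Y ^ (m + 1 + (m + 1))) =
      T'.F (X ^ (0 + 0) * Y ^ (m + 1 + (m + 1))) := by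
    have e := h.parameters.zero_even m
    rw [h'.parameters.zero_even m] at e
    simp only [At, pairing, Matrix.of_apply, ← hQ] at e
    refine (h.revLex.isGramSchmidt 0 (m + 1) 0).eq_at_double h.posDef
      (h'.revLex.isGramSchmidt 0 (m + 1) 0) ?_ ?_ (r := Y * T.Q 0 m 0) ?_ ?_ e.symm
    · rintro ⟨i, j⟩ h1 ⟨i', j'⟩ h2
      simp only [revLexBelow, Set.mem_insert_iff, Prod.mk.injEq, Set.mem_ofPred_eq] at h1 h2
      dsimp only
      by_cases hj : j + j' = 2 * m + 1
      · have hi : i + i' = 0 := by simp at h1 h2; omega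
        rwa [hi, hj]
      · exact ih _ _ (by simp at h1 h2; omega) (by simp at h1 h2; omega)
    · rintro ⟨i, j⟩ h1 ⟨i', j'⟩ h2
      simp only [revLexBelow, Set.mem_insert_iff, Prod.mk.injEq, Set.mem_ofPred_eq, Prod.mk_add_mk,
        ne_eq] at h1 h2 ⊢
      simp at h1 h2
      omega
    · refine Y_mul_mem_supp hb fun i j hij => ?_
      simp only [revLexBelow, Set.mem_insert_iff, Prod.mk.injEq, Set.mem_ofPred_eq] at hij ⊢
      simp
      omega
    · rw [coeff_Y_mul]
      exact hlead.ne'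
  intro i j hi hj
  obtain rfl : i = 0 := by omega
  rcases (by omega : j ≤ 2 * m ∨ j = 2 * m + 1 ∨ j = m + 1 + (m + 1)) with hj | rfl | rfl
  · exact ih 0 j (by omega) hj
  · exact h1
  · exact h2

/-- The four missing moments are reached in the order `(2n+1, 2m+1)`, `(2n+1, 2m+2)`, `(2n+2,
2m+1)`, `(2n+2, 2m+2)`, since each argument uses the preceding ones. -/
lemma agree_succ_succ (h : T.IsConstructedWith s) (h' : T'.IsConstructedWith s) {n m : ℕ}
    (ih₁ : AgreeUpTo T.F T'.F (n + 1) m) (ih₂ : AgreeUpTo T.F T'.F n (m + 1)) :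
    AgreeUpTo T.F T'.F (n + 1) (m + 1) := by
  have hP := ih₁.lex_eq h.posDef h.lex h'.lex
  have hQ := ih₂.revLex_eq h.posDef h.revLex h'.revLex
  set p := T.P (n + 1) m (Fin.last m) with hp
  set q := T.Q n (m + 1) (Fin.last n) with hq
  have hbP : p ∈ supp {p | p.1 ≤ n + 1 ∧ p.2 ≤ m} := h.lex.mem_box (n + 1) m (Fin.last m)
  have hbQ : q ∈ supp {p | p.1 ≤ n ∧ p.2 ≤ m + 1} := h.revLex.mem_box n (m + 1) (Fin.last n)
  have hbYP : Y * p ∈ supp {p | p.1 ≤ n + 1 ∧ p.2 ≤ m + 1} :=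
    Y_mul_mem_supp hbP fun i j hij => by simp only [Set.mem_ofPred_eq] at hij ⊢; omega
  have hlP : 0 < p.coeff (expo (n + 1) m) := h.lex.leading_pos (n + 1) m (Fin.last m)
  have hlQ : 0 < q.coeff (expo n (m + 1)) := h.revLex.leading_pos n (m + 1) (Fin.last n)
  have h11 : T.F (X ^ (n + 1 + n) * Y ^ (m + (m + 1))) =
      T'.F (X ^ (n + 1 + n) * Y ^ (m + (m + 1))) := by
    have e := h.parameters.odd_odd n m
    rw [h'.parameters.odd_odd n m] at e
    simp only [K, pairing, Matrix.of_apply, ← hP, ← hQ] at e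
    refine eq_at_top (r := p * q)
      (A := {p | p.1 ≤ 2 * n + 1 ∧ p.2 ≤ 2 * m + 1}) (mul_mem_supp hbP hbQ ?_) ?_ e.symm ?_
    · rintro ⟨i, j⟩ h1 ⟨i', j'⟩ h2
      simp only [Set.mem_ofPred_eq, Prod.mk_add_mk, Set.mem_insert_iff, Prod.mk.injEq] at h1 h2 ⊢
      omega
    · rw [coeff_mul_of_mem_supp hbP hbQ]
      · exact mul_ne_zero hlP.ne' hlQ.ne'
      · rintro ⟨i, j⟩ h1 ⟨i', j'⟩ h2 h3
        simp only [Set.mem_ofPred_eq, Prod.mk_add_mk, Prod.mk.injEq] at h1 h2 h3 ⊢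
        omega
    · intro i j hij hne
      simp only [Set.mem_ofPred_eq, ne_eq, Prod.mk.injEq] at hij hne
      by_cases hi : i ≤ 2 * n
      · exact ih₂ i j hi (by omega)
      · exact ih₁ i j (by omega) (by omega)
  have h12 : T.F (X ^ (n + 1 + n) * Y ^ (m + 1 + (m + 1))) =
      T'.F (X ^ (n + 1 + n) * Y ^ (m + 1 + (m + 1))) := by
    have e := h.parameters.odd_even n m
    rw [h'.parameters.odd_even n m] at e
    simp only [J2, pairing, Matrix.of_apply, Matrix.neg_apply, neg_inj, ← hP, ← hQ] at e
    refine eq_at_top (r := Y * p * q)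
      (A := {p | p.1 ≤ 2 * n + 1 ∧ p.2 ≤ 2 * m + 2}) (mul_mem_supp hbYP hbQ ?_) ?_ e.symm ?_
    · rintro ⟨i, j⟩ h1 ⟨i', j'⟩ h2
      simp only [Set.mem_ofPred_eq, Prod.mk_add_mk, Set.mem_insert_iff, Prod.mk.injEq] at h1 h2 ⊢
      omega
    · rw [coeff_mul_of_mem_supp hbYP hbQ, coeff_Y_mul]
      · exact mul_ne_zero hlP.ne' hlQ.ne'
      · rintro ⟨i, j⟩ h1 ⟨i', j'⟩ h2 h3
        simp only [Set.mem_ofPred_eq, Prod.mk_add_mk, Prod.mk.injEq] at h1 h2 h3 ⊢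
        omega
    · intro i j hij hne
      simp only [Set.mem_ofPred_eq, ne_eq, Prod.mk.injEq] at hij hne
      by_cases hi : i ≤ 2 * n
      · exact ih₂ i j hi (by omega)
      · by_cases hj : j ≤ 2 * m
        · exact ih₁ i j (by omega) hj
        · obtain rfl : i = n + 1 + n := by omega
          obtain rfl : j = m + (m + 1) := by omega
          exact h11
  have agree1 : ∀ i j, i ≤ 2 * n + 1 → j ≤ 2 * m + 2 →
      T.F (X ^ i * Y ^ j) = T'.F (X ^ i * Y ^ j) := by
    intro i j hi hj
    by_cases hi : i ≤ 2 * n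
    · exact ih₂ i j hi (by omega)
    · by_cases hj : j ≤ 2 * m
      · exact ih₁ i j (by omega) hj
      · obtain rfl : i = n + 1 + n := by omega
        rcases (by omega : j = m + (m + 1) ∨ j = m + 1 + (m + 1)) with rfl | rfl
        · exact h11
        · exact h12
  have h21 : T.F (X ^ (n + 1 + (n + 1)) * Y ^ (m + 1 + m)) =
      T'.F (X ^ (n + 1 + (n + 1)) * Y ^ (m + 1 + m)) := by
    have hg := h.lex.isGramSchmidt (n + 1) (m + 1) (Fin.last m).castSucc
    have hg' := h'.lex.isGramSchmidt (n + 1) (m + 1) (Fin.last m).castSucc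
    -- This polynomial lies in the new box, but where the `x`-degrees of two of its monomials add up
    -- to `2n+2`, the `y`-degrees add up to at most `2m`. So it involves only moments known at this
    -- stage.
    have hPP : T.P (n + 1) (m + 1) (Fin.last m).castSucc =
        T'.P (n + 1) (m + 1) (Fin.last m).castSucc := by
      refine hg.eq h.posDef hg' ?_
      rintro ⟨i, j⟩ h1 ⟨i', j'⟩ h2
      simp only [lexBelow, Set.mem_insert_iff, Prod.mk.injEq, Set.mem_ofPred_eq, Fin.val_castSucc,
        Fin.val_last] at h1 h2
      dsimp only
      by_cases hi : i + i' ≤ 2 * n + 1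
      · exact agree1 _ _ hi (by omega)
      · exact ih₁ _ _ (by omega) (by omega)
    have e := h.parameters.even_odd n m
    rw [h'.parameters.even_odd n m] at e
    simp only [J1, pairing, Matrix.of_apply, ← hP, ← hPP] at e
    refine eq_at_top (r := Y * p * T.P (n + 1) (m + 1) (Fin.last m).castSucc)
      (A := {p | p.1 ≤ 2 * n + 1 ∧ p.2 ≤ 2 * m + 2 ∨ p.1 = 2 * n + 2 ∧ p.2 ≤ 2 * m + 1})
      (mul_mem_supp hbYP hg.mem ?_) ?_ e.symm ?_
    · rintro ⟨i, j⟩ h1 ⟨i', j'⟩ h2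
      simp only [lexBelow, Set.mem_insert_iff, Prod.mk.injEq, Set.mem_ofPred_eq, Fin.val_castSucc,
        Fin.val_last, Prod.mk_add_mk] at h1 h2 ⊢
      omega
    · rw [coeff_mul_of_mem_supp hbYP hg.mem, coeff_Y_mul]
      · exact mul_ne_zero hlP.ne' hg.leading_pos.ne'
      · rintro ⟨i, j⟩ h1 ⟨i', j'⟩ h2 h3
        simp only [lexBelow, Set.mem_insert_iff, Prod.mk.injEq, Set.mem_ofPred_eq,
          Fin.val_castSucc, Fin.val_last, Prod.mk_add_mk] at h1 h2 h3 ⊢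
        omega
    · intro i j hij hne
      simp only [Set.mem_ofPred_eq, ne_eq, Prod.mk.injEq] at hij hne
      rcases hij with hij | hij
      · exact agree1 i j hij.1 hij.2
      · exact ih₁ i j (by omega) (by omega)
  have agree2 : ∀ i j, i ≤ 2 * n + 2 → j ≤ 2 * m + 1 →
      T.F (X ^ i * Y ^ j) = T'.F (X ^ i * Y ^ j) := by
    intro i j hi hj
    by_cases hi : i ≤ 2 * n + 1
    · exact agree1 i j hi (by omega)
    · by_cases hj : j ≤ 2 * m
      · exact ih₁ i j (by omega) hj
      · obtain rfl : i = n + 1 + (n + 1) := by omega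
        obtain rfl : j = m + 1 + m := by omega
        exact h21
  have h22 : T.F (X ^ (n + 1 + (n + 1)) * Y ^ (m + 1 + (m + 1))) =
      T'.F (X ^ (n + 1 + (n + 1)) * Y ^ (m + 1 + (m + 1))) := by
    have e := h.parameters.even_even n m
    rw [h'.parameters.even_even n m] at e
    simp only [J1, pairing, Matrix.of_apply, ← hP] at e
    refine (h.lex.isGramSchmidt (n + 1) (m + 1) (Fin.last (m + 1))).eq_at_double h.posDef
      (h'.lex.isGramSchmidt (n + 1) (m + 1) (Fin.last (m + 1))) ?_ ?_ (r := Y * p) ?_ ?_ e.symm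
    · rintro ⟨i, j⟩ h1 ⟨i', j'⟩ h2
      simp only [lexBelow, Set.mem_insert_iff, Prod.mk.injEq, Set.mem_ofPred_eq,
        Fin.val_last] at h1 h2
      dsimp only
      by_cases hi : i + i' ≤ 2 * n + 1
      · exact agree1 _ _ hi (by omega)
      · exact agree2 _ _ (by omega) (by omega)
    · rintro ⟨i, j⟩ h1 ⟨i', j'⟩ h2
      simp only [lexBelow, Set.mem_insert_iff, Prod.mk.injEq, Set.mem_ofPred_eq, Prod.mk_add_mk,
        ne_eq, Fin.val_last] at h1 h2 ⊢
      omega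
    · refine supp_mono ?_ hbYP
      rintro ⟨i, j⟩ hij
      simp only [lexBelow, Set.mem_insert_iff, Prod.mk.injEq, Set.mem_ofPred_eq,
        Fin.val_last] at hij ⊢
      omega
    · rw [coeff_Y_mul]
      exact hlP.ne'
  intro i j hi hj
  by_cases hi : i ≤ 2 * n + 1
  · exact agree1 i j hi (by omega)
  · by_cases hj : j ≤ 2 * m + 1
    · exact agree2 i j (by omega) hj
    · obtain rfl : i = n + 1 + (n + 1) := by omega
      obtain rfl : j = m + 1 + (m + 1) := by omega
      exact h22

lemma agree (h : T.IsConstructedWith s) (h' : T'.IsConstructedWith s) (n m : ℕ) :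
    AgreeUpTo T.F T'.F n m := by
  induction n generalizing m with
  | zero =>
    induction m with
    | zero => exact agree_zero_zero h h'
    | succ m ih => exact agree_zero_succ h h' ih
  | succ n ihn =>
    induction m with
    | zero => exact agree_succ_zero h h' (ihn 0)
    | succ m ih => exact agree_succ_succ h h' ih (ihn (m + 1))

/-- A system is determined by its parameters. -/
theorem unique (h : T.IsConstructedWith s) (h' : T'.IsConstructedWith s) : T = T' := by
  have hF : T.F = T'.F := functional_ext fun i j => h.agree h' i j i j (by omega) (by omega)
  have hP : T.P = T'.P := by
    funext n m
    exact (h.agree h' n m).lex_eq h.posDef h.lex h'.lex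
  have hQ : T.Q = T'.Q := by
    funext n m
    exact (h.agree h' n m).revLex_eq h.posDef h.revLex h'.revLex
  cases T
  cases T'
  simp only at hF hP hQ
  subst hF hP hQ
  rfl

end System.IsConstructedWith

/-! ### Chebyshev polynomials of the second kind -/

lemma eval_U_add_two (n : ℕ) (x : ℝ) :
    (U ℝ (n + 2 : ℕ)).eval x = 2 * x * (U ℝ (n + 1 : ℕ)).eval x - (U ℝ n).eval x := by
  push_cast
  simp [Polynomial.Chebyshev.U_add_two]

/-- In `U_{n+1} = x U_n + T_{n+1}` each step adds at most `1`. The bound dominates the Poisson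
series. -/
lemma abs_eval_U_le (n : ℕ) {x : ℝ} (hx : |x| ≤ 1) : |(U ℝ n).eval x| ≤ n + 1 := by
  induction n with
  | zero => simp
  | succ n ih =>
    push_cast
    rw [Polynomial.Chebyshev.U_eq_X_mul_U_add_T, Polynomial.eval_add, Polynomial.eval_mul,
      Polynomial.eval_X]
    have h1 := Polynomial.Chebyshev.abs_eval_T_real_le_one (n + 1) hx
    have h2 : |x * (U ℝ n).eval x| ≤ n + 1 := by
      rw [abs_mul]
      exact (mul_le_of_le_one_left (abs_nonneg _) hx).trans ih
    exact (abs_add_le _ _).trans (add_le_add h2 h1)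

/-- The Chebyshev polynomials of the second kind are orthogonal with respect to `√(1 - x ^ 2)`. -/
theorem integral_sqrt_mul_U_mul_U (i j : ℕ) :
    ∫ x in Set.Icc (-1 : ℝ) 1, √(1 - x ^ 2) * ((U ℝ i).eval x * (U ℝ j).eval x) =
      if i = j then Real.pi / 2 else 0 := by
  -- The weight is `1 - x²` times the density `√((1-x²)⁻¹)` of `measureT`, so the known integrals of
  -- the `T n` apply.
  have h1 : ∫ x in Set.Icc (-1 : ℝ) 1, √(1 - x ^ 2) * ((U ℝ i).eval x * (U ℝ j).eval x) =
      ∫ x, (1 - x ^ 2) * ((U ℝ i).eval x * (U ℝ j).eval x) ∂Polynomial.Chebyshev.measureT := by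
    rw [Polynomial.Chebyshev.integral_measureT, integral_Icc_eq_integral_Ioc,
      ← intervalIntegral.integral_of_le (by norm_num)]
    refine intervalIntegral.integral_congr fun x hx => ?_
    rw [Set.uIcc_of_le (by norm_num)] at hx
    have h0 : 0 ≤ 1 - x ^ 2 := by nlinarith [hx.1, hx.2]
    have h2 : (1 - x ^ 2) * √((1 - x ^ 2)⁻¹) = √(1 - x ^ 2) := by
      rw [Real.sqrt_inv, ← div_eq_mul_inv, Real.div_sqrt]
    rw [← h2]
    ring
  -- With `x = cos θ` the integrand becomes `sin((i+1)θ) sin((j+1)θ)`, which is half of `cos((i-j)θ)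
  -- - cos((i+j+2)θ)`.
  have h3 : ∫ x, (1 - x ^ 2) * ((U ℝ i).eval x * (U ℝ j).eval x) ∂Polynomial.Chebyshev.measureT =
      ∫ x, 2⁻¹ * ((Polynomial.Chebyshev.T ℝ (i - j)).eval x -
        (Polynomial.Chebyshev.T ℝ (i + j + 2)).eval x) ∂Polynomial.Chebyshev.measureT := by
    rw [Polynomial.Chebyshev.integral_measureT_eq_integral_cos,
      Polynomial.Chebyshev.integral_measureT_eq_integral_cos]
    congr 1
    funext θ
    rw [Polynomial.Chebyshev.T_real_cos, Polynomial.Chebyshev.T_real_cos, ← Real.sin_sq]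
    have e : Real.sin θ ^ 2 * ((U ℝ i).eval (Real.cos θ) * (U ℝ j).eval (Real.cos θ)) =
        ((U ℝ i).eval (Real.cos θ) * Real.sin θ) * ((U ℝ j).eval (Real.cos θ) * Real.sin θ) := by
      ring
    rw [e, Polynomial.Chebyshev.U_real_cos, Polynomial.Chebyshev.U_real_cos]
    push_cast
    rw [show ((i : ℝ) - j) * θ = (i + 1) * θ - (j + 1) * θ by ring,
      show ((i : ℝ) + j + 2) * θ = (i + 1) * θ + (j + 1) * θ by ring, Real.cos_sub, Real.cos_add]
    ring
  rw [h1, h3, integral_const_mul, integral_sub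
    (Polynomial.Chebyshev.integrable_measureT (by fun_prop))
    (Polynomial.Chebyshev.integrable_measureT (by fun_prop)),
    Polynomial.Chebyshev.integral_eval_T_real_measureT_of_ne_zero (n := i + j + 2) (by omega)]
  split_ifs with h
  · subst h
    rw [sub_self, Polynomial.Chebyshev.integral_eval_T_real_measureT_zero]
    ring
  · rw [Polynomial.Chebyshev.integral_eval_T_real_measureT_of_ne_zero (by omega)]
    simp

/-! ### Summation of the Poisson kernel -/

lemma one_sub_sq_pos {c : ℝ} (hc : |c| < 1) : 0 < 1 - c ^ 2 := by
  have := (sq_lt_one_iff_abs_lt_one c).2 hc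
  linarith

/-- The denominator of the density. -/
def poissonDenom (c x y : ℝ) : ℝ :=
  4 * c ^ 2 * (x ^ 2 + y ^ 2) - 4 * c * (1 + c ^ 2) * (x * y) + (1 - c ^ 2) ^ 2

lemma summable_abs_pow_mul_sq {c : ℝ} (hc : |c| < 1) :
    Summable fun n : ℕ => |c| ^ n * ((n : ℝ) + 1) ^ 2 := by
  have h := fun k : ℕ => summable_pow_mul_geometric_of_norm_lt_one (R := ℝ) k
    (r := |c|) (by simpa using hc)
  refine (((h 2).add ((h 1).mul_left 2)).add (h 0)).congr fun n => ?_
  ring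

/-- The Poisson kernel of the Chebyshev polynomials of the second kind. -/
theorem hasSum_U_mul_U {c x y : ℝ} (hc : |c| < 1) (hx : |x| ≤ 1) (hy : |y| ≤ 1) :
    HasSum (fun n : ℕ => c ^ n * ((U ℝ n).eval x * (U ℝ n).eval y))
      ((1 - c ^ 2) / poissonDenom c x y) := by
  set b : ℕ → ℝ := fun n => c ^ n * ((U ℝ n).eval x * (U ℝ n).eval y) with hb
  have hs : Summable b := by
    refine (summable_abs_pow_mul_sq hc).of_norm_bounded fun n => ?_
    rw [Real.norm_eq_abs, abs_mul, abs_pow, abs_mul, sq]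
    have h1 := abs_eval_U_le n hx
    have h2 := abs_eval_U_le n hy
    gcongr
  -- With `x = cos θ`, `y = cos φ`, the products `U_n(x) U_n(y)` satisfy the recurrence with
  -- characteristic roots `exp(i(±θ ± φ))`; these are the coefficients, with powers of `c` inserted.
  have hrec : ∀ n, b (n + 4) = 4 * (x * y) * c * b (n + 3)
      - (4 * x ^ 2 + 4 * y ^ 2 - 2) * c ^ 2 * b (n + 2) + 4 * (x * y) * c ^ 3 * b (n + 1)
      - c ^ 4 * b n := by
    intro n
    simp only [hb, eval_U_add_two]
    ring
  have hk := fun k : ℕ => (summable_nat_add_iff k).2 hs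
  have e0 := hs.sum_add_tsum_nat_add 1
  have e1 := hs.sum_add_tsum_nat_add 2
  have e2 := hs.sum_add_tsum_nat_add 3
  have e3 := hs.sum_add_tsum_nat_add 4
  have e : ∑' n, b (n + 4) = 4 * (x * y) * c * ∑' n, b (n + 3)
      - (4 * x ^ 2 + 4 * y ^ 2 - 2) * c ^ 2 * ∑' n, b (n + 2)
      + 4 * (x * y) * c ^ 3 * ∑' n, b (n + 1) - c ^ 4 * ∑' n, b n := by
    have h4 := ((((hk 3).hasSum.mul_left (4 * (x * y) * c)).sub
      ((hk 2).hasSum.mul_left ((4 * x ^ 2 + 4 * y ^ 2 - 2) * c ^ 2))).add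
      ((hk 1).hasSum.mul_left (4 * (x * y) * c ^ 3))).sub (hs.hasSum.mul_left (c ^ 4))
    rw [← h4.tsum_eq]
    exact tsum_congr hrec
  have b0 : b 0 = 1 := by simp [hb]
  have b1 : b 1 = c * (2 * x * (2 * y)) := by simp [hb]
  have b2 : b 2 = c ^ 2 * ((4 * x ^ 2 - 1) * (4 * y ^ 2 - 1)) := by
    simp [hb, Polynomial.Chebyshev.U_two]
  have b3 : b 3 = c ^ 3 * ((8 * x ^ 3 - 4 * x) * (8 * y ^ 3 - 4 * y)) := by
    have h3 : ∀ t : ℝ, (U ℝ (3 : ℕ)).eval t = 8 * t ^ 3 - 4 * t := by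
      intro t
      rw [eval_U_add_two 1]
      simp [Polynomial.Chebyshev.U_two]
      ring
    simp only [hb, h3]
  simp only [Finset.sum_range_succ, Finset.sum_range_zero, b0, b1, b2, b3] at e0 e1 e2 e3
  -- Summing the recurrence and expressing each tail by the full sum and `b 0, …, b 3` leaves a
  -- linear equation for the sum. It also shows that the denominator does not vanish, as `1 - c² ≠
  -- 0`.
  have key : poissonDenom c x y * ∑' n, b n = 1 - c ^ 2 := by
    rw [eq_sub_of_add_eq' e3, eq_sub_of_add_eq' e2, eq_sub_of_add_eq' e1,
      eq_sub_of_add_eq' e0] at e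
    rw [poissonDenom]
    linear_combination e
  have hD : poissonDenom c x y ≠ 0 := left_ne_zero_of_mul (key.trans_ne (one_sub_sq_pos hc).ne')
  rw [← key, mul_div_cancel_left₀ _ hD]
  exact hs.hasSum

/-! ### The deformed Chebyshev measure -/

/-- The square `[-1, 1] × [-1, 1]`. -/
def square : Set (ℝ × ℝ) := Set.Icc (-1) 1 ×ˢ Set.Icc (-1) 1

lemma measurableSet_square : MeasurableSet square := measurableSet_Icc.prod measurableSet_Icc

lemma isCompact_square : IsCompact square := isCompact_Icc.prod isCompact_Icc

lemma abs_fst_le {z : ℝ × ℝ} (hz : z ∈ square) : |z.1| ≤ 1 := abs_le.2 hz.1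

lemma abs_snd_le {z : ℝ × ℝ} (hz : z ∈ square) : |z.2| ≤ 1 := abs_le.2 hz.2

lemma density_eq (c : ℝ) (z : ℝ × ℝ) : density c z = 4 / Real.pi ^ 2 *
    (√(1 - z.1 ^ 2) * √(1 - z.2 ^ 2) * ((1 - c ^ 2) / poissonDenom c z.1 z.2)) := by
  rw [density, poissonDenom]
  ring

/-- Completing the square in `x` leaves a remainder that vanishes only for `y² = 1`. There a zero
would require `4c²x² = (1+c²)²`, but `4c²x² ≤ 4c² < (1+c²)²`. -/
lemma poissonDenom_pos {c x y : ℝ} (hc : |c| < 1) (hx : |x| ≤ 1) (hy : |y| ≤ 1) :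
    0 < poissonDenom c x y := by
  have hx2 : x ^ 2 ≤ 1 := (sq_le_one_iff_abs_le_one x).2 hx
  have hy2 : y ^ 2 ≤ 1 := (sq_le_one_iff_abs_le_one y).2 hy
  have hc2 := one_sub_sq_pos hc
  have e : poissonDenom c x y =
      (2 * c * x - (1 + c ^ 2) * y) ^ 2 + (1 - c ^ 2) ^ 2 * (1 - y ^ 2) := by
    rw [poissonDenom]; ring
  rw [e]
  rcases hy2.lt_or_eq with hy2 | hy2
  · have : 0 < 1 - y ^ 2 := by linarith
    positivity
  · rw [hy2, sub_self, mul_zero, add_zero]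
    refine sq_pos_of_ne_zero fun h => ?_
    have h6 : (2 * c * x) ^ 2 = (1 + c ^ 2) ^ 2 := by
      rw [sub_eq_zero.1 h, mul_pow, hy2, mul_one]
    nlinarith [mul_nonneg (sq_nonneg c) (sub_nonneg.2 hx2), mul_pos hc2 hc2]

lemma density_nonneg {c : ℝ} (hc : |c| < 1) {z : ℝ × ℝ} (hz : z ∈ square) : 0 ≤ density c z := by
  have h1 := poissonDenom_pos hc (abs_fst_le hz) (abs_snd_le hz)
  have h2 := one_sub_sq_pos hc
  rw [density_eq]
  positivity

lemma density_pos {c : ℝ} (hc : |c| < 1) {z : ℝ × ℝ} (h₁ : |z.1| < 1) (h₂ : |z.2| < 1) :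
    0 < density c z := by
  have h1 := poissonDenom_pos hc h₁.le h₂.le
  have h2 := one_sub_sq_pos hc
  have h3 := one_sub_sq_pos h₁
  have h4 := one_sub_sq_pos h₂
  rw [density_eq]
  positivity

lemma continuousOn_density {c : ℝ} (hc : |c| < 1) : ContinuousOn (density c) square := by
  rw [show density c = fun z => density c z from rfl]
  simp only [density_eq]
  refine ContinuousOn.mul continuousOn_const (ContinuousOn.mul (by fun_prop)
    (ContinuousOn.div continuousOn_const ?_ fun z hz =>
      (poissonDenom_pos hc (abs_fst_le hz) (abs_snd_le hz)).ne'))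
  simp only [poissonDenom]
  fun_prop

lemma measurable_density (c : ℝ) : Measurable (density c) := by
  unfold density
  fun_prop

lemma continuous_value (f : Poly) : Continuous (value f) := by
  refine (MvPolynomial.continuous_eval f).comp (continuous_pi fun i => ?_)
  fin_cases i
  · exact continuous_fst
  · exact continuous_snd

lemma integrableOn_density_mul {c : ℝ} (hc : |c| < 1) {f : ℝ × ℝ → ℝ} (hf : Continuous f) :
    IntegrableOn (fun z => density c z * f z) square :=
  ((continuousOn_density hc).mul hf.continuousOn).integrableOn_compact isCompact_square

lemma chebyshevMeasure_eq (c : ℝ) : chebyshevMeasure c =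
    (volume.restrict square).withDensity fun z => ENNReal.ofReal (density c z) := rfl

lemma integrable_chebyshevMeasure {c : ℝ} (hc : |c| < 1) {f : ℝ × ℝ → ℝ} (hf : Continuous f) :
    Integrable f (chebyshevMeasure c) := by
  rw [chebyshevMeasure_eq, integrable_withDensity_iff_integrable_smul₀'
    (measurable_density c).ennreal_ofReal.aemeasurable (by simp)]
  refine (integrableOn_density_mul hc hf).congr ?_
  filter_upwards [ae_restrict_mem measurableSet_square] with z hz
  rw [ENNReal.toReal_ofReal (density_nonneg hc hz), smul_eq_mul]

lemma integral_chebyshevMeasure {c : ℝ} (hc : |c| < 1) (f : ℝ × ℝ → ℝ) :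
    ∫ z, f z ∂chebyshevMeasure c = ∫ z in square, density c z * f z := by
  rw [chebyshevMeasure_eq, integral_withDensity_eq_integral_toReal_smul
    (measurable_density c).ennreal_ofReal (by simp)]
  refine integral_congr_ae ?_
  filter_upwards [ae_restrict_mem measurableSet_square] with z hz
  rw [ENNReal.toReal_ofReal (density_nonneg hc hz), smul_eq_mul]

/-- The Poisson series may be integrated termwise, and each term factors into two one-dimensional
integrals. Only the term `n = i = j` survives, and its factor `(π/2)²` cancels `4/π²`. -/
theorem integral_U_mul_U {c : ℝ} (hc : |c| < 1) (i j : ℕ) :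
    ∫ z, (U ℝ i).eval z.1 * (U ℝ j).eval z.2 ∂chebyshevMeasure c = if i = j then c ^ i else 0 := by
  rw [integral_chebyshevMeasure hc]
  set F : ℕ → ℝ × ℝ → ℝ := fun n z => 4 / Real.pi ^ 2 * (√(1 - z.1 ^ 2) * √(1 - z.2 ^ 2) *
    (c ^ n * ((U ℝ n).eval z.1 * (U ℝ n).eval z.2))) * ((U ℝ i).eval z.1 * (U ℝ j).eval z.2)
    with hF
  have hint : ∀ n, ∫ z in square, F n z =
      if n = i then (if i = j then c ^ i else 0) else 0 := by
    intro n
    have h1 : ∀ z, F n z = 4 / Real.pi ^ 2 * c ^ n *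
        ((√(1 - z.1 ^ 2) * ((U ℝ n).eval z.1 * (U ℝ i).eval z.1)) *
          (√(1 - z.2 ^ 2) * ((U ℝ n).eval z.2 * (U ℝ j).eval z.2))) := by
      intro z; simp only [hF]; ring
    simp only [h1]
    rw [integral_const_mul, square, Measure.volume_eq_prod,
      setIntegral_prod_mul (fun x => √(1 - x ^ 2) * ((U ℝ n).eval x * (U ℝ i).eval x))
        (fun x => √(1 - x ^ 2) * ((U ℝ n).eval x * (U ℝ j).eval x)),
      integral_sqrt_mul_U_mul_U, integral_sqrt_mul_U_mul_U]
    by_cases hni : n = i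
    · subst hni
      by_cases hnj : n = j
      · simp only [hnj, if_true]
        have := Real.pi_ne_zero
        field_simp
        ring
      · simp [hnj]
    · simp [hni]
  have hsum := hasSum_integral_of_dominated_convergence (μ := volume.restrict square) (F := F)
    (f := fun z => density c z * ((U ℝ i).eval z.1 * (U ℝ j).eval z.2))
    (fun n _ => 4 / Real.pi ^ 2 * (|c| ^ n * ((n : ℝ) + 1) ^ 2) * ((i + 1) * (j + 1)))
    (fun n => (by fun_prop : Continuous (F n)).aestronglyMeasurable) ?_ ?_ ?_ ?_
  · simp only [hint] at hsum
    exact hsum.unique (hasSum_ite_eq i _)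
  · intro n
    filter_upwards [ae_restrict_mem measurableSet_square] with z hz
    have a1 := abs_eval_U_le n (abs_fst_le hz)
    have a2 := abs_eval_U_le n (abs_snd_le hz)
    have a3 := abs_eval_U_le i (abs_fst_le hz)
    have a4 := abs_eval_U_le j (abs_snd_le hz)
    have r1 : √(1 - z.1 ^ 2) ≤ 1 := Real.sqrt_le_one.2 (by nlinarith)
    have r2 : √(1 - z.2 ^ 2) ≤ 1 := Real.sqrt_le_one.2 (by nlinarith)
    have a5 : √(1 - z.1 ^ 2) * √(1 - z.2 ^ 2) ≤ 1 := mul_le_one₀ r1 (Real.sqrt_nonneg _) r2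
    have a6 : |(U ℝ n).eval z.1| * |(U ℝ n).eval z.2| ≤ ((n : ℝ) + 1) ^ 2 := by
      rw [sq]; gcongr
    have a7 : √(1 - z.1 ^ 2) * √(1 - z.2 ^ 2) *
        (|c| ^ n * (|(U ℝ n).eval z.1| * |(U ℝ n).eval z.2|)) ≤
        1 * (|c| ^ n * ((n : ℝ) + 1) ^ 2) := by gcongr
    rw [one_mul] at a7
    simp only [hF, Real.norm_eq_abs, abs_mul, abs_pow, abs_div,
      abs_of_nonneg (Real.sqrt_nonneg _), abs_of_pos Real.pi_pos, abs_of_pos (four_pos (α := ℝ))]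
    gcongr
  · filter_upwards with z
    exact ((summable_abs_pow_mul_sq hc).mul_left _).mul_right _
  · simp only [tsum_mul_left, tsum_mul_right]
    exact (continuousOn_const.integrableOn_compact isCompact_square)
  · filter_upwards [ae_restrict_mem measurableSet_square] with z hz
    rw [density_eq]
    exact (((hasSum_U_mul_U hc (abs_fst_le hz) (abs_snd_le hz)).mul_left _).mul_left _).mul_right _

/-- Integration with respect to the deformed Chebyshev measure. -/
def chebyshevFunctional (c : ℝ) (hc : |c| < 1) : Poly →ₗ[ℝ] ℝ where
  toFun f := ∫ z, value f z ∂chebyshevMeasure c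
  map_add' f g := by
    simp only [value, map_add]
    exact integral_add (integrable_chebyshevMeasure hc (continuous_value f))
      (integrable_chebyshevMeasure hc (continuous_value g))
  map_smul' r f := by
    simp only [value, MvPolynomial.smul_eval, RingHom.id_apply, smul_eq_mul]
    exact integral_const_mul _ _

lemma chebyshevFunctional_apply {c : ℝ} (hc : |c| < 1) (f : Poly) :
    chebyshevFunctional c hc f = ∫ z, value f z ∂chebyshevMeasure c := rfl

lemma value_mul (f g : Poly) (z : ℝ × ℝ) : value (f * g) z = value f z * value g z := by
  simp [value]

/-- The density is positive on the open square. If the integral of `f²` vanishes, then by continuity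
so does `f` there, and a polynomial that is zero on a product of infinite sets is zero. -/
theorem isPosDef_chebyshevFunctional {c : ℝ} (hc : |c| < 1) :
    IsPosDef (chebyshevFunctional c hc) := by
  intro f hf
  rw [chebyshevFunctional_apply, integral_chebyshevMeasure hc]
  simp only [value_mul]
  have h0 : 0 ≤ᵐ[volume.restrict square] fun z => density c z * (value f z * value f z) := by
    filter_upwards [ae_restrict_mem measurableSet_square] with z hz
    exact mul_nonneg (density_nonneg hc hz) (mul_self_nonneg _)
  refine lt_of_le_of_ne (integral_nonneg_of_ae h0) fun h => hf ?_
  have h1 := (setIntegral_eq_zero_iff_of_nonneg_ae h0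
    (integrableOn_density_mul hc ((continuous_value f).mul (continuous_value f)))).1 h.symm
  set V : Set (ℝ × ℝ) := Set.Ioo (-1) 1 ×ˢ Set.Ioo (-1) 1 with hV
  have hVs : V ⊆ square := Set.prod_mono Set.Ioo_subset_Icc_self Set.Ioo_subset_Icc_self
  have h2 := Measure.eqOn_open_of_ae_eq (ae_restrict_of_ae_restrict_of_subset hVs h1)
    (isOpen_Ioo.prod isOpen_Ioo)
    (((continuousOn_density hc).mul
      ((continuous_value f).mul (continuous_value f)).continuousOn).mono hVs) continuousOn_const
  refine MvPolynomial.funext_set (fun _ => Set.Ioo (-1 : ℝ) 1)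
    (fun _ => Set.Ioo_infinite (by norm_num)) fun v hv => ?_
  have hv0 := hv 0 trivial
  have hv1 := hv 1 trivial
  have h3 := h2 (show (v 0, v 1) ∈ V from ⟨hv0, hv1⟩)
  have h4 : value f (v 0, v 1) = 0 := by
    have h5 := density_pos hc (z := (v 0, v 1)) (abs_lt.2 hv0) (abs_lt.2 hv1)
    exact mul_self_eq_zero.1 ((mul_eq_zero.1 h3).resolve_left h5.ne')
  have h6 : ![v 0, v 1] = v := by ext i; fin_cases i <;> rfl
  rw [value, h6] at h4
  rw [h4, map_zero]

/-- The interchange of the two variables. -/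
def swap : Poly →ₐ[ℝ] Poly := MvPolynomial.aeval ![Y, X]

lemma swap_X : swap X = Y := by simp [swap, X]

lemma swap_Y : swap Y = X := by simp [swap, Y]

lemma value_swap (f : Poly) (z : ℝ × ℝ) : value (swap f) z = value f z.swap := by
  induction f using MvPolynomial.induction_on with
  | C a => simp [value, swap]
  | add p q hp hq => simp only [value, map_add] at *; rw [hp, hq]
  | mul_X p i hp =>
    rw [map_mul, value_mul, value_mul, hp]
    congr 1
    fin_cases i <;> simp [value, swap, X, Y]

lemma chebyshevFunctional_swap {c : ℝ} (hc : |c| < 1) (f : Poly) :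
    chebyshevFunctional c hc (swap f) = chebyshevFunctional c hc f := by
  simp only [chebyshevFunctional_apply, integral_chebyshevMeasure hc, value_swap]
  have h : ∀ z : ℝ × ℝ, density c z = density c z.swap := by
    intro z
    simp only [density_eq, poissonDenom, Prod.fst_swap, Prod.snd_swap]
    ring
  have h' : (fun z => density c z * value f z.swap) =
      fun z => (fun w => density c w * value f w) z.swap := by
    funext z
    rw [h z]
  rw [h', square, Measure.volume_eq_prod, ← Measure.prod_restrict]
  exact integral_prod_swap (fun z => density c z * value f z)

/-! ### The shift of the Chebyshev polynomials -/

/-- The Chebyshev polynomials of the second kind as a sequence of polynomials. -/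
def sequenceU : Polynomial.Sequence ℝ where
  elems' n := U ℝ n
  degree_eq' n := Polynomial.Chebyshev.degree_U_natCast ℝ n

lemma sequenceU_apply (n : ℕ) : sequenceU n = U ℝ n := rfl

lemma isUnit_leadingCoeff_sequenceU (n : ℕ) : IsUnit (sequenceU n).leadingCoeff := by
  rw [sequenceU_apply, Polynomial.Chebyshev.leadingCoeff_U_natCast]
  simp

/-- The Chebyshev polynomials of the second kind as a basis. -/
def basisU : Module.Basis ℕ ℝ (Polynomial ℝ) := sequenceU.basis isUnit_leadingCoeff_sequenceU

lemma basisU_apply (n : ℕ) : basisU n = U ℝ n :=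
  sequenceU.basis_eq_self isUnit_leadingCoeff_sequenceU n

/-- The linear map that sends `U n` to `U (n + 1)`. -/
def shift : Polynomial ℝ →ₗ[ℝ] Polynomial ℝ := basisU.constr ℝ fun n => U ℝ (n + 1 : ℕ)

lemma shift_U (n : ℕ) : shift (U ℝ n) = U ℝ (n + 1 : ℕ) := by
  rw [← basisU_apply, shift, Module.Basis.constr_basis]

/-- This is the Clebsch-Gordan rule. By `key`, raising both indices by one only adds a new top term.
-/
lemma U_add_mul_U (n i : ℕ) :
    U ℝ (n + i : ℕ) * U ℝ i = ∑ k ∈ Finset.range (i + 1), U ℝ (n + 2 * k : ℕ) := by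
  have key : ∀ a b : ℕ, U ℝ (a + 1 : ℕ) * U ℝ (b + 1 : ℕ) =
      U ℝ a * U ℝ b + U ℝ (a + b + 2 : ℕ) := by
    intro a b
    induction b using Nat.strong_induction_on generalizing a with
    | _ b ih =>
      match b with
      | 0 =>
        push_cast
        have := Polynomial.Chebyshev.U_add_two ℝ a
        simp only [Polynomial.Chebyshev.U_one, add_zero, Polynomial.Chebyshev.U_zero]
        rw [this]; ring
      | 1 =>
        have h1 := Polynomial.Chebyshev.U_add_two ℝ a
        have h2 := Polynomial.Chebyshev.U_add_two ℝ (a + 1)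
        have h3 := Polynomial.Chebyshev.U_two ℝ
        push_cast
        rw [show (a : ℤ) + 1 + 2 = a + 1 + 2 by ring, h2,
          show (a : ℤ) + 1 + 1 = a + 2 by ring, h1, h3,
          Polynomial.Chebyshev.U_one]
        ring
      | b + 2 =>
        have h1 := ih (b + 1) (by omega) a
        have h2 := ih b (by omega) a
        have h3 := Polynomial.Chebyshev.U_add_two ℝ (b + 1)
        have h4 := Polynomial.Chebyshev.U_add_two ℝ b
        have h5 := Polynomial.Chebyshev.U_add_two ℝ (a + b + 2)
        push_cast at h1 h2 ⊢
        rw [show (b : ℤ) + 1 + 1 = b + 2 by ring,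
          show (a : ℤ) + (b + 1) + 2 = a + b + 3 by ring] at h1
        rw [show (b : ℤ) + 1 + 2 = b + 3 by ring, show (b : ℤ) + 1 + 1 = b + 2 by ring] at h3
        rw [show (a : ℤ) + b + 2 + 2 = a + b + 4 by ring,
          show (a : ℤ) + b + 2 + 1 = a + b + 3 by ring] at h5
        rw [show (b : ℤ) + 2 + 1 = b + 3 by ring, show (a : ℤ) + (b + 2) + 2 = a + b + 4 by ring,
          h3, h5]
        linear_combination 2 * Polynomial.X * h1 - h2 + U ℝ a * (-h4)
  induction i with
  | zero => simp
  | succ i ih =>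
    rw [Finset.sum_range_succ, ← ih, ← add_assoc, key]
    congr 3
    ring

lemma U_mul_U_succ (n i : ℕ) : U ℝ n * U ℝ (n + i + 1 : ℕ) =
    ∑ k ∈ Finset.range (n + 1), U ℝ (i + 1 + 2 * k : ℕ) := by
  rw [← U_add_mul_U, mul_comm]
  congr 3
  ring

/-- Multiplication by `U i` of consecutive Chebyshev polynomials. -/
lemma U_mul_U_eq_shift {n i : ℕ} (h : i ≤ n) :
    U ℝ n * U ℝ i = (if i = n then 1 else 0) + shift (U ℝ (n - 1) * U ℝ i) := by
  -- `U_n U_i` is the sum of every second `U` from `U_{n-i}` to `U_{n+i}`. Shifting `U_{n-1} U_i`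
  -- gives the same sum, except that for `i = n` the bottom term `U_0 = 1` is not reached.
  split_ifs with hi
  · subst hi
    cases i with
    -- The index `n - 1` is an integer, and `U ℝ (-1) = 0`.
    | zero => simp
    | succ i =>
      have h1 := U_add_mul_U 0 (i + 1)
      have h2 := U_mul_U_succ i 0
      rw [zero_add] at h1
      rw [h1, Finset.sum_range_succ', show ((i + 1 : ℕ) : ℤ) - 1 = i by push_cast; ring,
        show i + 1 = i + 0 + 1 by ring, h2, map_sum, add_comm]
      congr 1
      · simp
      · refine Finset.sum_congr rfl fun k _ => ?_
        rw [shift_U]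
        congr 2
        ring
  · obtain ⟨d, rfl⟩ : ∃ d, n = d + 1 + i := ⟨n - i - 1, by omega⟩
    have e : ((d + 1 + i : ℕ) : ℤ) - 1 = (d + i : ℕ) := by push_cast; ring
    rw [e, U_add_mul_U, U_add_mul_U, zero_add, map_sum]
    refine Finset.sum_congr rfl fun k _ => ?_
    rw [shift_U]
    congr 2
    ring

/-- One index beyond `U_mul_U_eq_shift`, the term missed by the shift is the bottom term `U_1`. -/
lemma U_mul_U_succ_eq_shift (n : ℕ) : U ℝ n * U ℝ (n + 1 : ℕ) =
    U ℝ (1 : ℕ) + shift (U ℝ (n - 1) * U ℝ (n + 1 : ℕ)) := by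
  cases n with
  | zero => simp
  | succ n =>
    have h1 := U_mul_U_succ (n + 1) 0
    have h2 := U_mul_U_succ n 1
    rw [add_zero] at h1
    rw [h1, Finset.sum_range_succ', show ((n + 1 : ℕ) : ℤ) - 1 = n by push_cast; ring, h2, map_sum,
      add_comm]
    congr 1
    refine Finset.sum_congr rfl fun k _ => ?_
    rw [shift_U]
    congr 2
    ring

/-! ### The functional on products of univariate polynomials -/

/-- A univariate polynomial as a polynomial in `x`. -/
def inX : Polynomial ℝ →ₐ[ℝ] Poly := Polynomial.aeval X

/-- A univariate polynomial as a polynomial in `y`. -/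
def inY : Polynomial ℝ →ₐ[ℝ] Poly := Polynomial.aeval Y

lemma inX_X : inX Polynomial.X = X := by simp [inX]

lemma inY_X : inY Polynomial.X = Y := by simp [inY]

lemma value_inX (f : Polynomial ℝ) (z : ℝ × ℝ) : value (inX f) z = f.eval z.1 := by
  induction f using Polynomial.induction_on' with
  | add p q hp hq => simp only [value, map_add, Polynomial.eval_add] at *; rw [hp, hq]
  | monomial n a => simp [value, inX, X, Polynomial.aeval_monomial]

lemma value_inY (f : Polynomial ℝ) (z : ℝ × ℝ) : value (inY f) z = f.eval z.2 := by
  induction f using Polynomial.induction_on' with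
  | add p q hp hq => simp only [value, map_add, Polynomial.eval_add] at *; rw [hp, hq]
  | monomial n a => simp [value, inY, Y, Polynomial.aeval_monomial]

/-- The bilinear form `(f, g) ↦ F (p * f(x) * g(y))`. -/
def form (F : Poly →ₗ[ℝ] ℝ) (p : Poly) :
    Polynomial ℝ →ₗ[ℝ] Polynomial ℝ →ₗ[ℝ] ℝ :=
  ((LinearMap.mul ℝ Poly).compl₁₂ inX.toLinearMap inY.toLinearMap).compr₂
    (F ∘ₗ LinearMap.mulLeft ℝ p)

lemma form_apply (F : Poly →ₗ[ℝ] ℝ) (p : Poly) (f g : Polynomial ℝ) :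
    form F p f g = F (p * (inX f * inY g)) := rfl

lemma apply_inX_mul_inY (F : Poly →ₗ[ℝ] ℝ) (f g : Polynomial ℝ) :
    F (inX f * inY g) = form F 1 f g := by rw [form_apply, one_mul]

/-- Polynomials of degree less than `n` are combinations of `U 0, …, U (n - 1)`. -/
lemma eq_zero_of_natDegree_lt {φ : Polynomial ℝ →ₗ[ℝ] ℝ} {n : ℕ} (h : ∀ k < n, φ (U ℝ k) = 0)
    {i : ℕ} (hi : i < n) : φ (Polynomial.X ^ i) = 0 := by
  have h1 : Polynomial.X ^ i ∈ Polynomial.degreeLT ℝ n := by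
    rw [Polynomial.mem_degreeLT, Polynomial.degree_X_pow]
    exact_mod_cast hi
  rw [← sequenceU.span_degreeLT fun k _ => isUnit_leadingCoeff_sequenceU k] at h1
  refine LinearMap.eqOn_span (f := φ) (g := 0) ?_ h1
  rintro _ ⟨k, hk, rfl⟩
  exact h k (by simpa using hk)

/-- The bilinear form `(f, g) ↦ ∫ f(x) g(y)`. -/
def chebyshevForm (c : ℝ) (hc : |c| < 1) : Polynomial ℝ →ₗ[ℝ] Polynomial ℝ →ₗ[ℝ] ℝ :=
  form (chebyshevFunctional c hc) 1

lemma chebyshevFunctional_inX_mul_inY {c : ℝ} (hc : |c| < 1) (f g : Polynomial ℝ) :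
    chebyshevFunctional c hc (inX f * inY g) = chebyshevForm c hc f g :=
  apply_inX_mul_inY _ _ _

lemma chebyshevForm_U_U {c : ℝ} (hc : |c| < 1) (i j : ℕ) :
    chebyshevForm c hc (U ℝ i) (U ℝ j) = if i = j then c ^ i else 0 := by
  rw [← chebyshevFunctional_inX_mul_inY, chebyshevFunctional_apply, ← integral_U_mul_U hc i j]
  simp only [value_mul, value_inX, value_inY]

/-- In the Chebyshev basis the form is diagonal with the geometric entries `c ^ i`. -/
lemma chebyshevForm_shift_shift {c : ℝ} (hc : |c| < 1) (f g : Polynomial ℝ) :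
    chebyshevForm c hc (shift f) (shift g) = c * chebyshevForm c hc f g := by
  have h : (chebyshevForm c hc).compl₁₂ shift shift = c • chebyshevForm c hc := by
    refine basisU.ext fun i => basisU.ext fun j => ?_
    simp only [LinearMap.compl₁₂_apply, LinearMap.smul_apply, basisU_apply, shift_U,
      chebyshevForm_U_U, add_left_inj, smul_eq_mul]
    split_ifs <;> ring
  exact LinearMap.congr_fun₂ h f g

lemma chebyshevForm_one_shift {c : ℝ} (hc : |c| < 1) (g : Polynomial ℝ) :
    chebyshevForm c hc 1 (shift g) = 0 := by
  have h : (chebyshevForm c hc 1) ∘ₗ shift = 0 := by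
    refine basisU.ext fun j => ?_
    have := chebyshevForm_U_U hc 0 (j + 1)
    simpa [basisU_apply, shift_U] using this
  exact LinearMap.congr_fun h g

lemma chebyshevForm_shift_one {c : ℝ} (hc : |c| < 1) (f : Polynomial ℝ) :
    chebyshevForm c hc (shift f) 1 = 0 := by
  have h : (chebyshevForm c hc).flip 1 ∘ₗ shift = 0 := by
    refine basisU.ext fun j => ?_
    have := chebyshevForm_U_U hc (j + 1) 0
    simpa [basisU_apply, shift_U] using this
  exact LinearMap.congr_fun h f

lemma chebyshevForm_one_one {c : ℝ} (hc : |c| < 1) : chebyshevForm c hc 1 1 = 1 := by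
  simpa using chebyshevForm_U_U hc 0 0

lemma chebyshevForm_one_U_mul_U {c : ℝ} (hc : |c| < 1) {l j : ℕ} (h : j ≤ l) :
    chebyshevForm c hc 1 (U ℝ l * U ℝ j) = if j = l then 1 else 0 := by
  rw [U_mul_U_eq_shift h, map_add, chebyshevForm_one_shift]
  split_ifs <;> simp [chebyshevForm_one_one]

/-- The polynomial `U_n(x) U_m(y) - c U_{n-1}(x) U_{m-1}(y)`. -/
def corner (c : ℝ) (n m : ℕ) : Poly :=
  inX (U ℝ n) * inY (U ℝ m) - c • (inX (U ℝ (n - 1)) * inY (U ℝ (m - 1)))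

lemma chebyshevFunctional_corner_mul {c : ℝ} (hc : |c| < 1) (n m : ℕ) (f g : Polynomial ℝ) :
    chebyshevFunctional c hc (corner c n m * (inX f * inY g)) =
      chebyshevForm c hc (U ℝ n * f) (U ℝ m * g) -
        c * chebyshevForm c hc (U ℝ (n - 1) * f) (U ℝ (m - 1) * g) := by
  simp only [← chebyshevFunctional_inX_mul_inY, ← smul_eq_mul (a := c), ← map_smul, ← map_sub]
  congr 1
  simp only [corner, map_mul, sub_mul, smul_mul_assoc]
  congr 1
  · ring
  · congr 1; ring

/-- After splitting both products by `U_mul_U_eq_shift`, the pairing of the two shifted parts is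
cancelled by the second term of `corner`, the mixed pairings vanish, and only the pairing of the
constants remains. -/
lemma chebyshevFunctional_corner_mul_U_U {c : ℝ} (hc : |c| < 1) {n m i j : ℕ} (hi : i ≤ n)
    (hj : j ≤ m) : chebyshevFunctional c hc (corner c n m * (inX (U ℝ i) * inY (U ℝ j))) =
      if i = n ∧ j = m then 1 else 0 := by
  rw [chebyshevFunctional_corner_mul, U_mul_U_eq_shift hi, U_mul_U_eq_shift hj]
  simp only [map_add, LinearMap.add_apply, chebyshevForm_shift_shift]
  split_ifs <;> simp_all [chebyshevForm_one_one, chebyshevForm_shift_one, chebyshevForm_one_shift]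

lemma chebyshevFunctional_corner_mul_U_succ_U {c : ℝ} (hc : |c| < 1) {n m j : ℕ} (hj : j ≤ m) :
    chebyshevFunctional c hc (corner c n m * (inX (U ℝ (n + 1 : ℕ)) * inY (U ℝ j))) =
      if j + 1 = m then c else 0 := by
  rw [chebyshevFunctional_corner_mul, U_mul_U_succ_eq_shift, U_mul_U_eq_shift hj]
  have h1 : U ℝ (1 : ℕ) = shift 1 := by simpa using (shift_U 0).symm
  -- The leftover `U_1 = shift 1` pairs with the shifted part in `y` to `c` times this number, the
  -- coefficient of `U_0` in `U_{m-1} U_j`.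
  have h2 : chebyshevForm c hc 1 (U ℝ (m - 1) * U ℝ j) = if j + 1 = m then 1 else 0 := by
    cases m with
    | zero => simp
    | succ m =>
      rw [show ((m + 1 : ℕ) : ℤ) - 1 = m by push_cast; ring]
      rcases hj.lt_or_eq with hj | rfl
      · rw [chebyshevForm_one_U_mul_U hc (by omega)]
        simp
      · have := chebyshevForm_one_shift hc (U ℝ (m - 1) * U ℝ (m + 1 : ℕ))
        rw [U_mul_U_succ_eq_shift, map_add, this, h1, chebyshevForm_one_shift]
        simp
  rw [h1]
  simp only [map_add, LinearMap.add_apply, chebyshevForm_shift_shift, h2]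
  split_ifs <;> simp_all [chebyshevForm_shift_one]

/-- The polynomial `U_{k+1}(x) - 2 c y U_k(x) + c ^ 2 U_{k-1}(x)`, multiplied by `U_l(y)`. -/
def ruled (c : ℝ) (k l : ℕ) : Poly :=
  inX (U ℝ (k + 1 : ℕ)) * inY (U ℝ l) -
    (2 * c) • (inX (U ℝ k) * inY (Polynomial.X * U ℝ l)) +
    c ^ 2 • (inX (U ℝ (k - 1)) * inY (U ℝ l))

lemma chebyshevForm_ruled {c : ℝ} (hc : |c| < 1) {k i : ℕ} (hi : i ≤ k + 1) (g : Polynomial ℝ) :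
    chebyshevForm c hc (U ℝ (k + 1 : ℕ) * U ℝ i) g -
      2 * c * chebyshevForm c hc (U ℝ k * U ℝ i) (Polynomial.X * g) +
      c ^ 2 * chebyshevForm c hc (U ℝ (k - 1) * U ℝ i) g =
      (if i = k + 1 then 1 - c ^ 2 else 0) * chebyshevForm c hc 1 g := by
  -- `ε` is the part of `U_k U_i` outside the shift: `0` for `i < k`, `1` for `i = k`, `U_1` for `i
  -- = k + 1`. The last case is responsible for the `-c²` in the result.
  obtain ⟨ε, he, he0, he1, he2⟩ : ∃ ε, U ℝ k * U ℝ i = ε + shift (U ℝ (k - 1) * U ℝ i) ∧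
      chebyshevForm c hc (shift ε) 1 = 0 ∧
      chebyshevForm c hc ε (U ℝ (1 : ℕ)) = (if i = k + 1 then c else 0) ∧
      ∀ j : ℕ, chebyshevForm c hc ε (U ℝ (j + 2 : ℕ)) = 0 := by
    rcases hi.lt_or_eq with hi | rfl
    · refine ⟨_, U_mul_U_eq_shift (by omega : i ≤ k), chebyshevForm_shift_one hc _, ?_, fun j => ?_⟩
      · have := chebyshevForm_U_U hc 0 1
        rw [if_neg (show i ≠ k + 1 by omega)]
        split_ifs <;> simp_all
      · have := chebyshevForm_U_U hc 0 (j + 2)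
        split_ifs <;> simp_all
    · refine ⟨_, U_mul_U_succ_eq_shift k, chebyshevForm_shift_one hc _, ?_, fun j => ?_⟩
      · rw [chebyshevForm_U_U]; simp
      · rw [chebyshevForm_U_U, if_neg (by omega)]
  have h1 : U ℝ (k + 1 : ℕ) * U ℝ i = (if i = k + 1 then 1 else 0) + shift (U ℝ k * U ℝ i) := by
    have := U_mul_U_eq_shift hi
    rwa [show ((k + 1 : ℕ) : ℤ) - 1 = k by push_cast; ring] at this
  set a := U ℝ (k - 1) * U ℝ i with ha
  set b := U ℝ k * U ℝ i with hb
  -- By linearity it suffices to test `g = U_j`. Expanding `X U_j` into its neighbours makes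
  -- everything cancel for `j ≥ 1`; for `j = 0` there is no lower neighbour, and the right side
  -- remains.
  have hlin : chebyshevForm c hc (U ℝ (k + 1 : ℕ) * U ℝ i) -
      (2 * c) • (chebyshevForm c hc b ∘ₗ LinearMap.mulLeft ℝ Polynomial.X) +
      c ^ 2 • chebyshevForm c hc a =
      (if i = k + 1 then 1 - c ^ 2 else 0 : ℝ) • chebyshevForm c hc 1 := by
    refine basisU.ext fun j => ?_
    simp only [basisU_apply, LinearMap.add_apply, LinearMap.sub_apply, LinearMap.smul_apply,
      LinearMap.comp_apply, LinearMap.mulLeft_apply, smul_eq_mul]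
    have hd : ∀ g, chebyshevForm c hc (if i = k + 1 then 1 else 0) g =
        (if i = k + 1 then 1 else 0) * chebyshevForm c hc 1 g := by
      intro g; split_ifs <;> simp
    cases j with
    | zero =>
      have h2 : Polynomial.X * U ℝ (0 : ℕ) = (2⁻¹ : ℝ) • U ℝ (1 : ℕ) := by
        have : (2 : Polynomial ℝ) = Polynomial.C 2 := rfl
        simp [this, ← Polynomial.smul_eq_C_mul, smul_smul]
      have h3 : chebyshevForm c hc (shift a) (U ℝ (1 : ℕ)) = c * chebyshevForm c hc a 1 := by
        rw [show U ℝ (1 : ℕ) = shift 1 by simpa using (shift_U 0).symm, chebyshevForm_shift_shift]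
      rw [h1, h2, map_smul, smul_eq_mul]
      conv_lhs => enter [1, 2]; rw [he]
      simp only [map_add, LinearMap.add_apply, hd, he1, h3]
      simp only [Nat.cast_zero, Polynomial.Chebyshev.U_zero, chebyshevForm_one_one,
        chebyshevForm_shift_one]
      split_ifs <;> ring
    | succ j =>
      have h2 : Polynomial.X * U ℝ (j + 1 : ℕ) = (2⁻¹ : ℝ) • (U ℝ (j + 2 : ℕ) + U ℝ j) := by
        have h := Polynomial.Chebyshev.U_add_two ℝ j
        have h' : (2 : Polynomial ℝ) = Polynomial.C 2 := rfl
        push_cast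
        rw [h, sub_add_cancel, h', mul_assoc, ← Polynomial.smul_eq_C_mul, smul_smul]
        norm_num
      have h3 : chebyshevForm c hc (shift a) (U ℝ (j + 2 : ℕ)) =
          c * chebyshevForm c hc a (U ℝ (j + 1 : ℕ)) := by
        rw [← shift_U (j + 1), chebyshevForm_shift_shift]
      have h4 : chebyshevForm c hc b (U ℝ (j + 2 : ℕ)) =
          c * chebyshevForm c hc a (U ℝ (j + 1 : ℕ)) := by
        rw [he, map_add, LinearMap.add_apply, he2, h3, zero_add]
      have h5 : chebyshevForm c hc (shift b) (U ℝ (j + 1 : ℕ)) =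
          c * chebyshevForm c hc b (U ℝ j) := by
        rw [← shift_U j, chebyshevForm_shift_shift]
      have h6 : chebyshevForm c hc 1 (U ℝ (j + 1 : ℕ)) = 0 := by
        rw [← shift_U j, chebyshevForm_one_shift]
      rw [h1, h2, map_smul, smul_eq_mul]
      simp only [map_add, LinearMap.add_apply, hd, h4, h5, h6]
      ring
  exact LinearMap.congr_fun hlin g

lemma chebyshevFunctional_ruled_mul {c : ℝ} (hc : |c| < 1) {k l i : ℕ} (hi : i ≤ k + 1)
    (g : Polynomial ℝ) :
    chebyshevFunctional c hc (ruled c k l * (inX (U ℝ i) * inY g)) =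
      (if i = k + 1 then 1 - c ^ 2 else 0) * chebyshevForm c hc 1 (U ℝ l * g) := by
  rw [← chebyshevForm_ruled hc hi]
  simp only [← chebyshevFunctional_inX_mul_inY]
  simp only [← smul_eq_mul (a := 2 * c), ← smul_eq_mul (a := c ^ 2), ← map_smul, ← map_sub,
    ← map_add]
  congr 1
  simp only [ruled, map_mul, sub_mul, add_mul, smul_mul_assoc]
  congr 1
  · congr 1
    · ring
    · congr 1; ring
  · congr 1; ring

/-! ### The orthonormal polynomials of the deformed Chebyshev measure -/

lemma coeff_inX_mul_inY (f g : Polynomial ℝ) (i j : ℕ) :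
    (inX f * inY g).coeff (expo i j) = f.coeff i * g.coeff j := by
  have h : form (MvPolynomial.lcoeff ℝ (expo i j)) 1 =
      (LinearMap.mul ℝ ℝ).compl₁₂ (Polynomial.lcoeff ℝ i) (Polynomial.lcoeff ℝ j) := by
    refine (Polynomial.basisMonomials ℝ).ext fun a => (Polynomial.basisMonomials ℝ).ext fun b => ?_
    have := coeff_X_pow_mul_Y_pow a b i j
    simp only [Polynomial.coe_basisMonomials, form_apply, one_mul, LinearMap.compl₁₂_apply,
      LinearMap.mul_apply', Polynomial.lcoeff_apply, Polynomial.coeff_monomial,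
      MvPolynomial.lcoeff_apply, inX, inY, Polynomial.aeval_monomial, map_one]
    rw [this]
    split_ifs <;> simp_all
  have h1 := LinearMap.congr_fun₂ h f g
  rwa [form_apply, one_mul] at h1

lemma inX_mul_inY_mem_supp {f g : Polynomial ℝ} {a b : ℕ} (hf : f.natDegree ≤ a)
    (hg : g.natDegree ≤ b) : inX f * inY g ∈ supp {p | p.1 ≤ a ∧ p.2 ≤ b} := by
  refine mem_supp.2 fun i j h => ?_
  rw [coeff_inX_mul_inY] at h
  exact ⟨(Polynomial.le_natDegree_of_ne_zero (left_ne_zero_of_mul h)).trans hf,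
    (Polynomial.le_natDegree_of_ne_zero (right_ne_zero_of_mul h)).trans hg⟩

lemma natDegree_U (n : ℕ) : (U ℝ n).natDegree = n :=
  Polynomial.Chebyshev.natDegree_U_natCast ℝ n

lemma natDegree_U_sub_one_le (n : ℕ) : (U ℝ (n - 1)).natDegree ≤ n - 1 := by
  rw [Polynomial.Chebyshev.natDegree_U]
  omega

lemma natDegree_X_mul_U (n : ℕ) : (Polynomial.X * U ℝ n).natDegree ≤ n + 1 := by
  refine Polynomial.natDegree_mul_le.trans ?_
  rw [natDegree_U, Polynomial.natDegree_X, add_comm]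

lemma coeff_U_self (n : ℕ) : (U ℝ n).coeff n = 2 ^ n := by
  have := Polynomial.Chebyshev.leadingCoeff_U_natCast ℝ n
  rwa [Polynomial.leadingCoeff, natDegree_U] at this

lemma coeff_U_sub_one (n : ℕ) : (U ℝ (n - 1)).coeff n = 0 := by
  cases n with
  | zero => simp
  | succ n =>
    exact Polynomial.coeff_eq_zero_of_natDegree_lt
      ((natDegree_U_sub_one_le (n + 1)).trans_lt (by omega))

lemma corner_mem_supp (c : ℝ) (n m : ℕ) : corner c n m ∈ supp {p | p.1 ≤ n ∧ p.2 ≤ m} := by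
  refine Submodule.sub_mem _ (inX_mul_inY_mem_supp (natDegree_U n).le (natDegree_U m).le)
    (Submodule.smul_mem _ _ (inX_mul_inY_mem_supp ?_ ?_))
  · exact (natDegree_U_sub_one_le n).trans (Nat.sub_le _ _)
  · exact (natDegree_U_sub_one_le m).trans (Nat.sub_le _ _)

lemma coeff_corner (c : ℝ) (n m : ℕ) : (corner c n m).coeff (expo n m) = 2 ^ n * 2 ^ m := by
  rw [corner, MvPolynomial.coeff_sub, MvPolynomial.coeff_smul, coeff_inX_mul_inY,
    coeff_inX_mul_inY, coeff_U_sub_one, coeff_U_self, coeff_U_self]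
  simp

lemma corner_zero (c : ℝ) (n : ℕ) : corner c n 0 = inX (U ℝ n) := by
  simp [corner]

/-- The middle term has degree `l + 1` in `y`, which stays within the allowed degree `m` precisely
because `l < m`. -/
lemma ruled_mem_supp (c : ℝ) (k : ℕ) {l m : ℕ} (h : l < m) :
    ruled c k l ∈ supp (insert (k + 1, l) (lexBelow (k + 1) m l)) := by
  refine Submodule.add_mem _ (Submodule.sub_mem _
    (supp_mono ?_ (inX_mul_inY_mem_supp (natDegree_U (k + 1)).le (natDegree_U l).le))
    (Submodule.smul_mem _ _ (supp_mono ?_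
      (inX_mul_inY_mem_supp (natDegree_U k).le (natDegree_X_mul_U l)))))
    (Submodule.smul_mem _ _ (supp_mono ?_
      (inX_mul_inY_mem_supp (natDegree_U_sub_one_le k) (natDegree_U l).le)))
  all_goals
    rintro ⟨i, j⟩ h'
    simp only [Set.mem_ofPred_eq, lexBelow, Set.mem_insert_iff, Prod.mk.injEq] at h' ⊢
    omega

lemma coeff_ruled (c : ℝ) (k l : ℕ) :
    (ruled c k l).coeff (expo (k + 1) l) = 2 ^ (k + 1) * 2 ^ l := by
  have h1 : (U ℝ k).coeff (k + 1) = 0 :=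
    Polynomial.coeff_eq_zero_of_natDegree_lt ((natDegree_U k).trans_lt k.lt_succ_self)
  have h2 : (U ℝ (k - 1)).coeff (k + 1) = 0 :=
    Polynomial.coeff_eq_zero_of_natDegree_lt ((natDegree_U_sub_one_le k).trans_lt (by omega))
  rw [ruled, MvPolynomial.coeff_add, MvPolynomial.coeff_sub, MvPolynomial.coeff_smul,
    MvPolynomial.coeff_smul]
  simp only [coeff_inX_mul_inY, h1, h2, coeff_U_self]
  simp

/-- The orthonormal polynomials with leading monomial `x ^ n * y ^ l`, `l < m`. -/
def edge (c : ℝ) : ℕ → ℕ → Poly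
  | 0, l => inY (U ℝ l)
  | k + 1, l => (√(1 - c ^ 2))⁻¹ • ruled c k l

/-- The lexicographical orthonormal polynomials of the deformed Chebyshev measure. -/
def lexFamily (c : ℝ) : LexFamily := fun n m l => if (l : ℕ) = m then corner c n m else edge c n l

/-- The reverse lexicographical orthonormal polynomials of the deformed Chebyshev measure. -/
def revLexFamily (c : ℝ) : RevLexFamily := fun n m l => swap (lexFamily c m n l)

lemma lexFamily_last (c : ℝ) (n m : ℕ) : lexFamily c n m (Fin.last m) = corner c n m := by
  simp [lexFamily]

lemma lexFamily_castSucc_last (c : ℝ) (n m : ℕ) :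
    lexFamily c n (m + 1) (Fin.last m).castSucc = edge c n m := by
  simp [lexFamily]

/-! ### Orthogonality and normalization of the two kinds of polynomials -/

variable {c : ℝ}

lemma chebyshevFunctional_corner_mul_X_Y (hc : |c| < 1) {n m i j : ℕ} (hi : i ≤ n) (hj : j ≤ m)
    (hij : i < n ∨ j < m) :
    chebyshevFunctional c hc (corner c n m * (X ^ i * Y ^ j)) = 0 := by
  have h : ∀ i' < i + 1, ∀ j' < j + 1,
      form (chebyshevFunctional c hc) (corner c n m) (U ℝ i') (U ℝ j') = 0 := by
    intro i' hi' j' hj'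
    rw [form_apply, chebyshevFunctional_corner_mul_U_U hc (by omega) (by omega),
      if_neg (by omega)]
  have h1 : ∀ i' < i + 1,
      (form (chebyshevFunctional c hc) (corner c n m)).flip (Polynomial.X ^ j) (U ℝ i') = 0 :=
    fun i' hi' => eq_zero_of_natDegree_lt (h i' hi') j.lt_succ_self
  have h2 := eq_zero_of_natDegree_lt h1 i.lt_succ_self
  simpa [form_apply, inX_X, inY_X] using h2

lemma chebyshevFunctional_ruled_mul_X_Y (hc : |c| < 1) {k l i j : ℕ} (hi : i ≤ k + 1)
    (hij : i < k + 1 ∨ j < l) :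
    chebyshevFunctional c hc (ruled c k l * (X ^ i * Y ^ j)) = 0 := by
  have h0 : j < l → chebyshevForm c hc 1 (U ℝ l * Polynomial.X ^ j) = 0 := fun hj =>
    eq_zero_of_natDegree_lt (φ := chebyshevForm c hc 1 ∘ₗ LinearMap.mulLeft ℝ (U ℝ l))
      (fun j' hj' => by
        rw [LinearMap.comp_apply, LinearMap.mulLeft_apply, chebyshevForm_one_U_mul_U hc hj'.le,
          if_neg hj'.ne]) hj
  have h1 : ∀ i' < i + 1,
      (form (chebyshevFunctional c hc) (ruled c k l)).flip (Polynomial.X ^ j) (U ℝ i') = 0 := by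
    intro i' hi'
    rw [LinearMap.flip_apply, form_apply, chebyshevFunctional_ruled_mul hc (by omega)]
    split_ifs with h
    · rw [h0 (by omega), mul_zero]
    · rw [zero_mul]
  have h2 := eq_zero_of_natDegree_lt h1 i.lt_succ_self
  simpa [form_apply, inX_X, inY_X] using h2

lemma chebyshevFunctional_edge_mul_X_Y (hc : |c| < 1) {n l i j : ℕ} (hi : i ≤ n)
    (hij : i < n ∨ j < l) : chebyshevFunctional c hc (edge c n l * (X ^ i * Y ^ j)) = 0 := by
  cases n with
  | zero =>
    obtain rfl : i = 0 := by omega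
    have h := eq_zero_of_natDegree_lt (i := j) (n := l)
      (φ := chebyshevForm c hc 1 ∘ₗ LinearMap.mulLeft ℝ (U ℝ l)) (fun j' hj' => by
        rw [LinearMap.comp_apply, LinearMap.mulLeft_apply, chebyshevForm_one_U_mul_U hc hj'.le,
          if_neg hj'.ne]) (by omega)
    rw [LinearMap.comp_apply, LinearMap.mulLeft_apply, ← chebyshevFunctional_inX_mul_inY] at h
    simpa [edge, inY_X] using h
  | succ k =>
    rw [edge, smul_mul_assoc, map_smul, chebyshevFunctional_ruled_mul_X_Y hc hi hij, smul_zero]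

/-- Expanding one factor, the lower term is orthogonal to `corner` and the leading term pairs to
`1`. -/
lemma chebyshevFunctional_corner_mul_self (hc : |c| < 1) (n m : ℕ) :
    chebyshevFunctional c hc (corner c n m * corner c n m) = 1 := by
  have h : chebyshevFunctional c hc
      (corner c n m * (inX (U ℝ (n - 1)) * inY (U ℝ (m - 1)))) = 0 := by
    cases n with
    | zero => simp
    | succ n =>
      cases m with
      | zero => simp
      | succ m =>
        rw [show ((n + 1 : ℕ) : ℤ) - 1 = n by push_cast; ring,
          show ((m + 1 : ℕ) : ℤ) - 1 = m by push_cast; ring,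
          chebyshevFunctional_corner_mul_U_U hc (by omega) (by omega), if_neg (by omega)]
  conv_lhs => enter [2, 2]; rw [corner]
  rw [mul_sub, mul_smul_comm, map_sub, map_smul, h,
    chebyshevFunctional_corner_mul_U_U hc le_rfl le_rfl]
  simp

lemma chebyshevFunctional_ruled_mul_self (hc : |c| < 1) (k l : ℕ) :
    chebyshevFunctional c hc (ruled c k l * ruled c k l) = 1 - c ^ 2 := by
  have h : chebyshevFunctional c hc (ruled c k l * (inX (U ℝ (k - 1)) * inY (U ℝ l))) = 0 := by
    cases k with
    | zero => simp
    | succ k =>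
      rw [show ((k + 1 : ℕ) : ℤ) - 1 = k by push_cast; ring,
        chebyshevFunctional_ruled_mul hc (by omega), if_neg (by omega), zero_mul]
  conv_lhs => enter [2, 2]; rw [ruled]
  rw [mul_add, mul_sub, mul_smul_comm, mul_smul_comm, map_add, map_sub, map_smul, map_smul, h,
    chebyshevFunctional_ruled_mul hc le_rfl, chebyshevFunctional_ruled_mul hc k.le_succ,
    if_neg (show k ≠ k + 1 by omega), chebyshevForm_one_U_mul_U hc le_rfl]
  simp

lemma chebyshevFunctional_edge_mul_self (hc : |c| < 1) (n l : ℕ) :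
    chebyshevFunctional c hc (edge c n l * edge c n l) = 1 := by
  cases n with
  | zero =>
    have h := chebyshevFunctional_inX_mul_inY hc 1 (U ℝ l * U ℝ l)
    rw [chebyshevForm_one_U_mul_U hc le_rfl] at h
    simpa [edge] using h
  | succ k =>
    have h := one_sub_sq_pos hc
    rw [edge, smul_mul_smul_comm, map_smul, chebyshevFunctional_ruled_mul_self, smul_eq_mul,
      ← mul_inv, Real.mul_self_sqrt h.le, inv_mul_cancel₀ h.ne']

lemma edge_mem_supp (c : ℝ) (n : ℕ) {l m : ℕ} (h : l < m) :
    edge c n l ∈ supp (insert (n, l) (lexBelow n m l)) := by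
  cases n with
  | zero =>
    have h1 := inX_mul_inY_mem_supp (f := 1) (a := 0) (by simp) (natDegree_U l).le
    rw [map_one, one_mul] at h1
    refine supp_mono ?_ h1
    rintro ⟨i, j⟩ h'
    simp only [Set.mem_ofPred_eq, lexBelow, Set.mem_insert_iff, Prod.mk.injEq] at h' ⊢
    omega
  | succ k => exact Submodule.smul_mem _ _ (ruled_mem_supp c k h)

lemma coeff_edge_pos (hc : |c| < 1) (n l : ℕ) : 0 < (edge c n l).coeff (expo n l) := by
  cases n with
  | zero =>
    have h1 := coeff_inX_mul_inY 1 (U ℝ l) 0 l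
    rw [map_one, one_mul, coeff_U_self] at h1
    rw [edge, h1]
    simp
  | succ k =>
    have h := one_sub_sq_pos hc
    rw [edge, MvPolynomial.coeff_smul, coeff_ruled, smul_eq_mul]
    positivity

theorem isLexOrthonormal_lexFamily (hc : |c| < 1) :
    IsLexOrthonormal (chebyshevFunctional c hc) (lexFamily c) where
  orthogonal n m l i j hij := by
    have hl := l.2
    rw [lexFamily]
    split_ifs with h
    · exact chebyshevFunctional_corner_mul_X_Y hc (by omega) (by omega) (by omega)
    · exact chebyshevFunctional_edge_mul_X_Y hc (by omega) (by omega)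
  normalized n m l := by
    rw [lexFamily]
    split_ifs with h
    · exact chebyshevFunctional_corner_mul_self hc n m
    · exact chebyshevFunctional_edge_mul_self hc n l
  triangular n m l i j hij := by
    have hl := l.2
    rw [lexFamily] at hij
    split_ifs at hij with h
    · have := mem_supp.1 (corner_mem_supp c n m) i j hij
      simp only [Set.mem_ofPred_eq] at this
      omega
    · have := mem_supp.1 (edge_mem_supp c n (by omega : (l : ℕ) < m)) i j hij
      simp only [Set.mem_ofPred_eq, lexBelow, Set.mem_insert_iff, Prod.mk.injEq] at this
      omega
  leading_pos n m l := by
    rw [lexFamily]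
    split_ifs with h
    · rw [h, coeff_corner]
      positivity
    · exact coeff_edge_pos hc n l

/-! ### The reverse lexicographical family, by symmetry -/

lemma coeff_swap (f : Poly) (i j : ℕ) : (swap f).coeff (expo i j) = f.coeff (expo j i) := by
  have h : MvPolynomial.lcoeff ℝ (expo i j) ∘ₗ swap.toLinearMap =
      MvPolynomial.lcoeff ℝ (expo j i) := by
    refine functional_ext fun a b => ?_
    simp only [LinearMap.comp_apply, AlgHom.toLinearMap_apply, map_mul, map_pow, swap_X, swap_Y,
      MvPolynomial.lcoeff_apply]
    rw [mul_comm, coeff_X_pow_mul_Y_pow, coeff_X_pow_mul_Y_pow]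
    simp only [and_comm]
  exact LinearMap.congr_fun h f

lemma swap_inX (f : Polynomial ℝ) : swap (inX f) = inY f := by
  rw [inX, inY, ← Polynomial.aeval_algHom_apply, swap_X]

lemma swap_inY (f : Polynomial ℝ) : swap (inY f) = inX f := by
  rw [inX, inY, ← Polynomial.aeval_algHom_apply, swap_Y]

lemma swap_corner (c : ℝ) (n m : ℕ) : swap (corner c n m) = corner c m n := by
  simp only [corner, map_sub, map_mul, map_smul, swap_inX, swap_inY]
  rw [mul_comm (inY (U ℝ n)), mul_comm (inY (U ℝ (n - 1)))]

lemma revLexFamily_last (c : ℝ) (n m : ℕ) : revLexFamily c n m (Fin.last n) = corner c n m := by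
  rw [revLexFamily, lexFamily_last, swap_corner]

theorem isRevLexOrthonormal_revLexFamily (hc : |c| < 1) :
    IsRevLexOrthonormal (chebyshevFunctional c hc) (revLexFamily c) where
  orthogonal n m l i j hij := by
    have h := (isLexOrthonormal_lexFamily hc).orthogonal m n l j i hij
    rw [← chebyshevFunctional_swap, map_mul swap, map_mul swap, map_pow, map_pow, swap_X, swap_Y,
      mul_comm (Y ^ j)] at h
    exact h
  normalized n m l := by
    rw [revLexFamily, ← map_mul, chebyshevFunctional_swap]
    exact (isLexOrthonormal_lexFamily hc).normalized m n l
  triangular n m l i j hij := by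
    rw [revLexFamily, coeff_swap] at hij
    exact (isLexOrthonormal_lexFamily hc).triangular m n l j i hij
  leading_pos n m l := by
    rw [revLexFamily, coeff_swap]
    exact (isLexOrthonormal_lexFamily hc).leading_pos m n l

/-- The system of the deformed Chebyshev measure. -/
def chebyshevSystem (c : ℝ) (hc : |c| < 1) : System where
  F := chebyshevFunctional c hc
  P := lexFamily c
  Q := revLexFamily c

/-! ### The parameters of the deformed Chebyshev measure -/

lemma X_mul_U (n : ℕ) :
    Polynomial.X * U ℝ n = (2⁻¹ : ℝ) • (U ℝ (n + 1 : ℕ) + U ℝ (n - 1)) := by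
  have h := Polynomial.Chebyshev.U_add_one ℝ n
  have h' : (2 : Polynomial ℝ) = Polynomial.C 2 := rfl
  push_cast
  rw [h, sub_add_cancel, h', mul_assoc, ← Polynomial.smul_eq_C_mul, smul_smul]
  norm_num

/-- `B(1, ·)` reads off the coefficient of `U_0`, and neither `U_n U_{n+1}` nor `U_n U_{n-1}` has
one. -/
lemma chebyshevForm_one_X_mul_U_mul_U (hc : |c| < 1) (n : ℕ) :
    chebyshevForm c hc 1 (U ℝ n * (Polynomial.X * U ℝ n)) = 0 := by
  have h1 : U ℝ n * U ℝ (n + 1 : ℕ) = shift (U ℝ n * U ℝ n) := by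
    have := U_mul_U_eq_shift (n.le_succ)
    rw [if_neg (by omega), zero_add, show ((n + 1 : ℕ) : ℤ) - 1 = n by push_cast; ring] at this
    rw [mul_comm, this]
  have h2 : chebyshevForm c hc 1 (U ℝ n * U ℝ (n - 1)) = 0 := by
    cases n with
    | zero => simp
    | succ n =>
      rw [show ((n + 1 : ℕ) : ℤ) - 1 = n by push_cast; ring, chebyshevForm_one_U_mul_U hc n.le_succ,
        if_neg (by omega)]
  rw [X_mul_U, mul_smul_comm, mul_add, map_smul, map_add, h1, chebyshevForm_one_shift, h2]
  simp

lemma chebyshevFunctional_X_mul_corner_zero (hc : |c| < 1) (n : ℕ) :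
    chebyshevFunctional c hc (X * corner c n 0 * corner c n 0) = 0 := by
  rw [← chebyshevFunctional_swap, corner_zero]
  simp only [map_mul, swap_X, swap_inX]
  have h := chebyshevForm_one_X_mul_U_mul_U hc n
  rw [← chebyshevFunctional_inX_mul_inY, map_one, one_mul, map_mul inY, map_mul inY, inY_X] at h
  rw [← h]
  congr 1
  ring

lemma isGramSchmidt_corner (hc : |c| < 1) (n m : ℕ) :
    IsGramSchmidt (chebyshevFunctional c hc) (lexBelow n m m) n m (corner c n m) := by
  have h := (isLexOrthonormal_lexFamily hc).isGramSchmidt n m (Fin.last m)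
  rwa [lexFamily_last, Fin.val_last] at h

lemma chebyshevFunctional_X_mul_corner_corner (hc : |c| < 1) (n : ℕ) :
    chebyshevFunctional c hc (X * corner c n 0 * corner c (n + 1) 0) = 1 / 2 := by
  have h := (isGramSchmidt_corner hc (n + 1) 0).leading_mul_apply_mul (r := X * corner c n 0)
    (X_mul_mem_supp (corner_mem_supp c n 0) fun i j hij => by
      simp only [Set.mem_ofPred_eq, lexBelow, Set.mem_insert_iff, Prod.mk.injEq] at hij ⊢
      omega)
  rw [coeff_X_mul, coeff_corner, coeff_corner] at h
  have h2 : (2 : ℝ) ^ n ≠ 0 := by positivity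
  rw [pow_succ] at h
  field_simp at h ⊢
  linarith

/-- The value is the quotient of the leading coefficients `2^n 2^m` and `2^n 2^(m+1)`. -/
lemma chebyshevFunctional_Y_mul_corner_corner (hc : |c| < 1) (n m : ℕ) :
    chebyshevFunctional c hc (Y * corner c n m * corner c n (m + 1)) = 1 / 2 := by
  have h := (isGramSchmidt_corner hc n (m + 1)).leading_mul_apply_mul (r := Y * corner c n m)
    (Y_mul_mem_supp (corner_mem_supp c n m) fun i j hij => by
      simp only [Set.mem_ofPred_eq, lexBelow, Set.mem_insert_iff, Prod.mk.injEq] at hij ⊢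
      omega)
  rw [coeff_Y_mul, coeff_corner, coeff_corner] at h
  have h2 : (2 : ℝ) ^ n * 2 ^ m ≠ 0 := by positivity
  have h3 : (2 : ℝ) ^ n * 2 ^ m *
      (2 * chebyshevFunctional c hc (Y * corner c n m * corner c n (m + 1)) - 1) = 0 := by
    rw [pow_succ] at h
    linear_combination h
  have h4 := (mul_eq_zero.1 h3).resolve_left h2
  linarith

/-- Expanding the first factor, only `U_{n+1}(x) U_m(y)` contributes. It exceeds the other corner by
one degree in `x`, which is where `c` appears. -/
lemma chebyshevFunctional_corner_mul_corner (hc : |c| < 1) (n m : ℕ) :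
    chebyshevFunctional c hc (corner c (n + 1) m * corner c n (m + 1)) = c := by
  have h : chebyshevFunctional c hc
      (corner c n (m + 1) * (inX (U ℝ n) * inY (U ℝ (m - 1)))) = 0 := by
    cases m with
    | zero => simp
    | succ m =>
      rw [show ((m + 1 : ℕ) : ℤ) - 1 = m by push_cast; ring,
        chebyshevFunctional_corner_mul_U_U hc le_rfl (by omega), if_neg (by omega)]
  rw [mul_comm]
  conv_lhs => enter [2, 2]; rw [corner]
  rw [show ((n + 1 : ℕ) : ℤ) - 1 = n by push_cast; ring, mul_sub, mul_smul_comm, map_sub, map_smul,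
    h, chebyshevFunctional_corner_mul_U_succ_U hc m.le_succ]
  simp

lemma Y_mul_corner (c : ℝ) (n m : ℕ) : Y * corner c (n + 1) m =
    inX (U ℝ (n + 1 : ℕ)) * inY (Polynomial.X * U ℝ m) -
      c • (inX (U ℝ n) * inY (Polynomial.X * U ℝ (m - 1))) := by
  rw [corner, show ((n + 1 : ℕ) : ℤ) - 1 = n by push_cast; ring, mul_sub, mul_smul_comm]
  simp only [map_mul, inY_X]
  congr 1
  · ring
  · congr 1; ring

lemma natDegree_X_mul_U_sub_one (m : ℕ) : (Polynomial.X * U ℝ (m - 1)).natDegree ≤ m := by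
  cases m with
  | zero => simp
  | succ m =>
    rw [show ((m + 1 : ℕ) : ℤ) - 1 = m by push_cast; ring]
    exact natDegree_X_mul_U m

lemma chebyshevFunctional_Y_mul_corner_mul_corner (hc : |c| < 1) (n m : ℕ) :
    chebyshevFunctional c hc (Y * corner c (n + 1) m * corner c n (m + 1)) = 0 := by
  have h1 : chebyshevFunctional c hc
      (corner c n (m + 1) * (inX (U ℝ n) * inY (Polynomial.X * U ℝ (m - 1)))) = 0 := by
    refine (isGramSchmidt_corner hc n (m + 1)).orthogonal _
      (supp_mono ?_ (inX_mul_inY_mem_supp (natDegree_U n).le (natDegree_X_mul_U_sub_one m)))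
    rintro ⟨i, j⟩ h
    simp only [Set.mem_ofPred_eq, lexBelow] at h ⊢
    omega
  have h2 : chebyshevFunctional c hc
      (corner c n (m + 1) * (inX (U ℝ (n + 1 : ℕ)) * inY (U ℝ (m - 1)))) = 0 := by
    cases m with
    | zero => simp
    | succ m =>
      rw [show ((m + 1 : ℕ) : ℤ) - 1 = m by push_cast; ring,
        chebyshevFunctional_corner_mul_U_succ_U hc (by omega), if_neg (by omega)]
  rw [mul_comm, Y_mul_corner, mul_sub, mul_smul_comm, map_sub, map_smul, h1, X_mul_U, map_smul,
    map_add, mul_smul_comm, mul_smul_comm, map_smul, mul_add, mul_add, map_add, h2,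
    chebyshevFunctional_corner_mul_U_succ_U hc le_rfl, if_neg (by omega)]
  simp

/-- Pairing with `ruled` retains only the term of top degree in `x`, and its factor in `y`
contributes `B(1, U_m · y U_m) = 0`. -/
lemma chebyshevFunctional_Y_mul_corner_mul_edge (hc : |c| < 1) (n m : ℕ) :
    chebyshevFunctional c hc (Y * corner c (n + 1) m * edge c (n + 1) m) = 0 := by
  rw [edge, mul_smul_comm, map_smul, mul_comm, Y_mul_corner, mul_sub, mul_smul_comm, map_sub,
    map_smul, chebyshevFunctional_ruled_mul hc le_rfl, chebyshevFunctional_ruled_mul hc n.le_succ,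
    if_neg (show n ≠ n + 1 by omega), chebyshevForm_one_X_mul_U_mul_U]
  simp

theorem hasParameters_chebyshevSystem (hc : |c| < 1) :
    (chebyshevSystem c hc).HasParameters (chebyshevParameters c) where
  zero_zero := by
    have h := chebyshevFunctional_inX_mul_inY hc 1 1
    rw [chebyshevForm_one_one, map_one, map_one, one_mul] at h
    simpa [chebyshevParameters, chebyshevSystem] using h.symm
  odd_zero n := by
    have h := chebyshevFunctional_X_mul_corner_zero hc n
    -- For `m = 0` the only entry of the vector is also its last one, hence a `corner`.
    rw [← lexFamily_last] at h
    rw [show chebyshevParameters c (2 * n + 1) 0 = 0 by simp [chebyshevParameters], ← h]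
    rfl
  even_zero n := by
    have h := chebyshevFunctional_X_mul_corner_corner hc n
    rw [← lexFamily_last, ← lexFamily_last] at h
    rw [show chebyshevParameters c (2 * n + 2) 0 = 1 / 2 by
      simp [chebyshevParameters, Nat.even_add], ← h]
    rfl
  zero_odd m := by
    have h := chebyshevFunctional_X_mul_corner_zero hc m
    rw [← lexFamily_last, ← chebyshevFunctional_swap, map_mul swap, map_mul swap, swap_X] at h
    rw [show chebyshevParameters c 0 (2 * m + 1) = 0 by simp [chebyshevParameters], ← h]
    rfl
  zero_even m := by
    have h := chebyshevFunctional_X_mul_corner_corner hc m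
    rw [← lexFamily_last, ← lexFamily_last, ← chebyshevFunctional_swap, map_mul swap, map_mul swap,
      swap_X] at h
    rw [show chebyshevParameters c 0 (2 * m + 2) = 1 / 2 by
      simp [chebyshevParameters, Nat.even_add], ← h]
    rfl
  odd_odd n m := by
    rw [System.K, pairing, Matrix.of_apply, chebyshevSystem]
    dsimp only
    rw [lexFamily_last, revLexFamily_last,
      chebyshevFunctional_corner_mul_corner]
    simp [chebyshevParameters]
  odd_even n m := by
    rw [System.J2, pairing, Matrix.neg_apply, Matrix.of_apply, chebyshevSystem]
    dsimp only
    rw [lexFamily_last, revLexFamily_last, chebyshevFunctional_Y_mul_corner_mul_corner]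
    simp [chebyshevParameters, Nat.odd_add, Nat.even_add]
  even_odd n m := by
    rw [System.J1, pairing, Matrix.of_apply, chebyshevSystem]
    dsimp only
    rw [lexFamily_last, lexFamily_castSucc_last, chebyshevFunctional_Y_mul_corner_mul_edge]
    simp [chebyshevParameters, Nat.odd_add, Nat.even_add]
  even_even n m := by
    rw [System.J1, pairing, Matrix.of_apply, chebyshevSystem]
    dsimp only
    rw [lexFamily_last, lexFamily_last, chebyshevFunctional_Y_mul_corner_corner]
    simp [chebyshevParameters, Nat.odd_add, Nat.even_add]

theorem isConstructedWith_chebyshevSystem (hc : |c| < 1) :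
    (chebyshevSystem c hc).IsConstructedWith (chebyshevParameters c) where
  posDef := isPosDef_chebyshevFunctional hc
  lex := isLexOrthonormal_lexFamily hc
  revLex := isRevLexOrthonormal_revLexFamily hc
  parameters := hasParameters_chebyshevSystem hc

/-- Lexicographical orthonormal polynomials with the same second index are orthonormal. -/
lemma IsLexOrthonormal.apply_mul {F : Poly →ₗ[ℝ] ℝ} {P : LexFamily} (h : IsLexOrthonormal F P)
    (n k m : ℕ) (i j : Fin (m + 1)) : F (P n m i * P k m j) = if n = k ∧ i = j then 1 else 0 := by
  have key : ∀ (n k : ℕ) (i j : Fin (m + 1)), k < n ∨ k = n ∧ j < i →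
      F (P n m i * P k m j) = 0 := by
    intro n k i j hlt
    refine (h.isGramSchmidt n m i).orthogonal _ (supp_mono ?_ (h.isGramSchmidt k m j).mem)
    have hj := j.2
    rintro ⟨a, b⟩ hab
    simp only [Set.mem_ofPred_eq, lexBelow, Set.mem_insert_iff, Prod.mk.injEq] at hab ⊢
    omega
  split_ifs with hij
  · obtain ⟨rfl, rfl⟩ := hij
    exact h.normalized n m i
  · by_cases hlt : k < n ∨ k = n ∧ j < i
    · exact key n k i j hlt
    · rw [mul_comm]
      exact key k n j i (by omega)

end

end DGIM

/-- For `|s₁₁| < 1` the construction with the given parameters is possible and unambiguous, and the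
resulting polynomials `ℙ_{n,m}` are orthonormal for the deformed Chebyshev measure:
`∫ ℙ_{n,m} ℙ_{k,m}ᵀ dμ = δ_{n,k} I_{m+1}`, the integrals being absolutely convergent. -/
theorem theorem3p1 (s₁₁ : ℝ) (hs : |s₁₁| < 1) :
    (∃! T : DGIM.System, T.IsConstructedWith (DGIM.chebyshevParameters s₁₁)) ∧
    ∀ T : DGIM.System, T.IsConstructedWith (DGIM.chebyshevParameters s₁₁) →
      ∀ (n k m : ℕ) (i j : Fin (m + 1)),
        Integrable (fun z => DGIM.value (T.P n m i) z * DGIM.value (T.P k m j) z)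
          (DGIM.chebyshevMeasure s₁₁) ∧
        ∫ z, DGIM.value (T.P n m i) z * DGIM.value (T.P k m j) z ∂DGIM.chebyshevMeasure s₁₁ =
          if n = k ∧ i = j then 1 else 0 := by
  refine ⟨⟨DGIM.chebyshevSystem s₁₁ hs, DGIM.isConstructedWith_chebyshevSystem hs, fun T hT =>
    hT.unique (DGIM.isConstructedWith_chebyshevSystem hs)⟩, fun T hT n k m i j => ⟨?_, ?_⟩⟩
  · exact DGIM.integrable_chebyshevMeasure hs
      ((DGIM.continuous_value _).mul (DGIM.continuous_value _))
  -- By uniqueness the functional of `T` is integration against the measure, so the integral is `F`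
  -- of the product.
  · obtain rfl := hT.unique (DGIM.isConstructedWith_chebyshevSystem hs)
    rw [← hT.lex.apply_mul n k m i j]
    simp only [← DGIM.value_mul]
    rfl
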